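/- Let $\mathsf X$ be a set, $J:\mathsf X\to\mathbb R$, let $\mathcal G$ be a set of functions $\mathsf X\to\mathbb R$ and $\mathbb P$ a probability measure on $\mathcal G$. For every $N\in\mathbb N=\{0,1,2,\dots\}$, let $A(g_1,\dots,g_N)$ denote the solution of the scenario problem $\min_{x\in\mathsf X}J(x)$ subject to $g_i(x)\le 0$, $i=1,\dots,N$, which is assumed to exist and to be unique for $\mathbb P^N$-almost every $(g_1,\dots,g_N)\in\mathcal G^N$; the events $\{(g_1,\dots,g_N,g): g(A(g_1,\dots,g_N))>0\}$ are assumed measurable. Let $V(x)=\mathbb P[g(x)>0]$ be the risk of $x\in\mathsf X$, and let $C(\epsilon,N)=\mathbb P^N\{(g_1,\dots,g_N): V(A(g_1,\dots,g_N))\le\epsilon\}$. Let $d\ge 1$ be an integer and assume that $(\mathcal G,\mathbb P,A)$ has fixed complexity $d$: for every $N\ge d$, with probability one on $(g_1,\dots,g_N)\sim\mathbb P^N$ there is exactly one choice of indices $1\le i_1<\dots<i_d\le N$ such that $A(g_1,\dots,g_N)=A(g_{i_1},\dots,g_{i_d})$. Let $0<\epsilon<\beta<1$ and $N_\star=\min\{N\in\mathbb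 N: C(\epsilon,N)\ge\beta\}$. For $\theta>0$, $v\in[0,1]$ and $N\in\mathbb N$ define $$f_\theta(v,N)=\begin{cases}1 & \text{if } v=0\text{ or }N=0,\\ \dfrac{v^{\theta-1}(1-v)^{N-\theta}}{B(\theta,N-\theta+1)} & \text{if } v\ne0,\ N\neq 0\text{ and }N>\theta,\\ N v^{N-1} & \text{otherwise,}\end{cases}$$ where $B$ is the Beta function. For a finite family $\mathcal D=\{(v_j,N_j)\}_{j=1}^M\subseteq[0,1]\times\mathbb N$, $M\ge1$, let $\theta_\star(\mathcal D)$ be a maximizer over $\theta\in(0,\infty)$ of $\ell(\theta;\mathcal D)=\frac1M\sum_{j=1}^M\log f_\theta(v_j,N_j)$ (with $\log 0=-\infty$), ties being broken by an arbitrary fixed rule that depends measurably on $\mathcal D$. Let $\hat N(\theta)=\min\{N\in\mathbb N:\int_0^\epsilon f_\theta(v,N)\,dv\ge\beta\}$. Let $N_1,N_{\max}\in\mathbb N$ and consider the following algorithm. At step $t=1,2,\dots$, draw $N_t$ fresh i.i.d. samples $g_1,\dots,g_{N_t}\sim\mathbb P$ (independent of the samples of the other steps), let $x_t=A(g_1,\dots,g_{N_t})$,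 let $\mathcal D_t=\{(V(x_s),N_s)\}_{s=1}^t$, let $\theta_t=\theta_\star(\mathcal D_t)$, and let $N_{t+1}=\min\{\hat N(\theta_t),N_{\max}\}$. Assume that $N_\star\le N_{\max}$. Then, with probability one, (i) $\theta_t\to d$ as $t\to\infty$, and (ii) there is $t_0\ge1$ such that $N_t\in[N_\star-1,N_\star+1]$ for all $t\ge t_0$. -/

import Mathlib

open MeasureTheory ProbabilityTheory Filter Topology

noncomputable section

namespace Scenario

section Problem

variable {X : Type*} {G : Set (X → ℝ)}

/-- `x` satisfies the sampled constraints `g₁(x) ≤ 0, …, g_N(x) ≤ 0`. -/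
def Feasible {N : ℕ} (g : Fin N → G) (x : X) : Prop :=
  ∀ i, (g i : X → ℝ) x ≤ 0

/-- `x` is the unique minimizer of `J` subject to the sampled constraints. -/
def IsUniqueSolution (J : X → ℝ) {N : ℕ} (g : Fin N → G) (x : X) : Prop :=
  Feasible g x ∧ ∀ y, Feasible g y → y ≠ x → J x < J y

variable [MeasurableSpace G]

/-- The joint law `P^N` of `N` independent constraints with law `P`. -/
def sampleLaw (P : Measure G) (N : ℕ) : Measure (Fin N → G) :=
  Measure.pi fun _ => P

/-- `A` returns, for every sample size `N` and almost every sample `(g₁, …, g_N)`, the solution of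
the scenario design problem with objective `J`, which exists and is unique. -/
def IsScenarioSolution (J : X → ℝ) (P : Measure G) (A : (N : ℕ) → (Fin N → G) → X) : Prop :=
  ∀ N, ∀ᵐ g ∂(sampleLaw P N), IsUniqueSolution J g (A N g)

/-- Measurability of the violation events `{(g₁, …, g_N, g) : g (A (g₁, …, g_N)) > 0}`. -/
def MeasurableViolation (A : (N : ℕ) → (Fin N → G) → X) : Prop :=
  ∀ N, MeasurableSet {p : (Fin N → G) × G | 0 < (p.2 : X → ℝ) (A N p.1)}

/-- The risk `V(x) = P[g(x) > 0]`. -/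
def risk (P : Measure G) (x : X) : ℝ :=
  P.real {g : G | 0 < (g : X → ℝ) x}

/-- `(G, P, A)` has fixed complexity `d`: for all `N ≥ d`, with probability one there is a unique
choice of indices `i₁ < ⋯ < i_d` with `A (g₁, …, g_N) = A (g_{i₁}, …, g_{i_d})`. -/
def HasFixedComplexity (P : Measure G) (A : (N : ℕ) → (Fin N → G) → X) (d : ℕ) : Prop :=
  ∀ N, d ≤ N → ∀ᵐ g ∂(sampleLaw P N), ∃! i : Fin d ↪o Fin N, A N g = A d (fun k => g (i k))

/-- `C(ε, N) = P^N {(g₁, …, g_N) : V(A(g₁, …, g_N)) ≤ ε}`. -/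
def confidence (P : Measure G) (A : (N : ℕ) → (Fin N → G) → X) (ε : ℝ) (N : ℕ) : ℝ :=
  (sampleLaw P N).real {g | risk P (A N g) ≤ ε}

/-- The optimal sample size `N⋆ = min {N : C(ε, N) ≥ β}`. -/
def optimalSampleSize (P : Measure G) (A : (N : ℕ) → (Fin N → G) → X) (ε β : ℝ) : ℕ :=
  sInf {N : ℕ | β ≤ confidence P A ε N}

end Problem

section Estimator

open Classical in
/-- The extended Beta-shaped likelihood `f_θ(v, N)`. -/
def betaLikelihood (θ v : ℝ) (N : ℕ) : ℝ :=
  if v = 0 ∨ N = 0 then 1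
  else if θ < N then v ^ (θ - 1) * (1 - v) ^ ((N : ℝ) - θ) / beta θ ((N : ℝ) - θ + 1)
  else (N : ℝ) * v ^ (N - 1)

/-- The log-likelihood `ℓ(θ; D) = (1/M) ∑ⱼ log f_θ(vⱼ, Nⱼ)`, with `log 0 = -∞`. -/
def logLikelihood {M : ℕ} (θ : ℝ) (D : Fin M → ℝ × ℕ) : EReal :=
  (∑ j, ENNReal.log (ENNReal.ofReal (betaLikelihood θ (D j).1 (D j).2))) / (M : EReal)

/-- `est` is a maximum likelihood estimator: it maps each nonempty data set in `[0,1] × ℕ` to a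
maximizer of the log-likelihood over `Θ = (0, ∞)`, ties being broken by any measurable rule. -/
structure IsMLE (est : (M : ℕ) → (Fin M → ℝ × ℕ) → ℝ) : Prop where
  measurable : ∀ M, Measurable (est M)
  pos : ∀ M, 0 < M → ∀ D : Fin M → ℝ × ℕ, (∀ j, (D j).1 ∈ Set.Icc (0 : ℝ) 1) → 0 < est M D
  isMax : ∀ M, 0 < M → ∀ D : Fin M → ℝ × ℕ, (∀ j, (D j).1 ∈ Set.Icc (0 : ℝ) 1) →
    ∀ θ : ℝ, 0 < θ → logLikelihood θ D ≤ logLikelihood (est M D) D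

/-- The sample size estimate `min {N : ∫₀^ε f_θ(v, N) dv ≥ β}`. -/
def sizeEstimate (θ ε β : ℝ) : ℕ :=
  sInf {N : ℕ | β ≤ ∫ v in (0 : ℝ)..ε, betaLikelihood θ v N}

/-- The sample size used at step `t + 1`, given the data set of the first `t` steps. -/
def nextSize (est : (M : ℕ) → (Fin M → ℝ × ℕ) → ℝ) (ε β : ℝ) (N₁ Nmax : ℕ) :
    (t : ℕ) → (Fin t → ℝ × ℕ) → ℕ
  | 0, _ => N₁
  | t + 1, D => min (sizeEstimate (est (t + 1) D) ε β) Nmax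

end Estimator

section Algorithm

variable {X : Type*} {G : Set (X → ℝ)} [MeasurableSpace G]

/-- The data set `D_t` after `t` steps of the algorithm, where `w s i` is the `i`-th constraint
available at step `s`; step `s` draws the first `N_s` of them. -/
def dataSet (P : Measure G) (A : (N : ℕ) → (Fin N → G) → X)
    (est : (M : ℕ) → (Fin M → ℝ × ℕ) → ℝ) (ε β : ℝ) (N₁ Nmax : ℕ) (w : ℕ → ℕ → G) :
    (t : ℕ) → Fin t → ℝ × ℕ
  | 0 => Fin.elim0
  | t + 1 =>
    let D := dataSet P A est ε β N₁ Nmax w t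
    let N := nextSize est ε β N₁ Nmax t D
    Fin.snoc (α := fun _ => ℝ × ℕ) D (risk P (A N fun i => w (t + 1) i), N)

/-- The sample size `N_t` of step `t ≥ 1`. -/
def sampleSize (P : Measure G) (A : (N : ℕ) → (Fin N → G) → X)
    (est : (M : ℕ) → (Fin M → ℝ × ℕ) → ℝ) (ε β : ℝ) (N₁ Nmax : ℕ) (w : ℕ → ℕ → G) (t : ℕ) : ℕ :=
  nextSize est ε β N₁ Nmax (t - 1) (dataSet P A est ε β N₁ Nmax w (t - 1))

/-- The estimate `θ_t` of step `t ≥ 1`. -/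
def estimate (P : Measure G) (A : (N : ℕ) → (Fin N → G) → X)
    (est : (M : ℕ) → (Fin M → ℝ × ℕ) → ℝ) (ε β : ℝ) (N₁ Nmax : ℕ) (w : ℕ → ℕ → G) (t : ℕ) : ℝ :=
  est t (dataSet P A est ε β N₁ Nmax w t)

end Algorithm

end Scenario

end

/-!
The observed risks have Beta laws. If `N < d`, the risk of the solution for `N` constraints is one
almost surely: otherwise, with positive probability, that solution satisfies all of `d + 1`
constraints, and two different sub-samples of size `d` give it (`ae_risk_eq_one`). If `N ≥ d`,
almost surely exactly one sub-sample of size `d` has a solution satisfying the other `N - d`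
constraints. For all `N` this says that `(1 - V)^(N - d)` has mean `1 / N.choose d`, where `V` is
the risk for `d` constraints; so `V` has law `Beta (d, 1)`, and conditioning gives the law
`Beta (d, N - d + 1)` for `N` constraints (`map_risk`).

The likelihood `f_θ(·, N)` is the Beta density with parameter `min θ N`, and its logarithm is
concave in `θ ∈ (0, N]` since `Γ` is log-convex. Fix `θ' ≠ d` with `θ' ≤ N`. The Hellinger
affinity of `Beta (θ', N - θ' + 1)` and `Beta (d, N - d + 1)` is less than one, so the
square roots of the likelihood ratios, multiplied by a constant `exp c > 1`, have mean at most one. The sample sizes are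
predictable, so the product of these factors over the steps with sample size `N` is a nonnegative
supermartingale and grows subexponentially: over these steps the log-likelihood ratio of `θ'`
against `d` is at most `-2c` times their number, up to `o(t)` (`ae_log_ratio_le`). By concavity the
log-likelihood ratio of any `θ` beyond `θ'` is at most a bounded multiple of that of `θ'`, the
multiple depending only on `θ` and `N` (`log_betaDensity_sub_le`). Hence the maximum likelihood
estimates eventually avoid all `θ` beyond `θ'` (`eventually_estimate_notMem`).

This separates `θ < d` from `d` on the steps with `N ≥ d`, and `θ > d` from `d` on the steps with
`N ≥ d + 1`, so the algorithm must not get stuck at small sample sizes. A risk equal to one at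
sample size `N` forces `θ_t ≥ N` ever after, while `θ < sizeEstimate θ ε β` always, because
`ε < β`; hence only finitely many steps have `N < d`. Then `θ_t` is eventually bounded
below by numbers close to `d`, which gives sample sizes at least `d + 1`, and then the upper bound (`tendsto_estimate`).

For `N ≥ d` the confidence `C(ε, N)` is the integral of `f_d(·, N)` over `[0, ε]`. That integral is
continuous in `θ` at `d` and strictly increasing in `N`, so for `θ` close to `d` the size estimate
is the optimal sample size or its successor (`eventually_sizeEstimate_mem`).
-/

open MeasureTheory ProbabilityTheory Filter Topology

noncomputable section

namespace Scenario

/-! ### The Beta densities -/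

/-- The density at `v` of the Beta distribution with parameters `θ` and `N - θ + 1`; the risk of a
solution with complexity `θ` computed from `N` constraints has this density. -/
def betaDensity (N : ℕ) (θ v : ℝ) : ℝ :=
  betaPDFReal θ ((N : ℝ) - θ + 1) v

theorem betaDensity_eq {N : ℕ} {θ v : ℝ} (h0 : 0 < v) (h1 : v < 1) :
    betaDensity N θ v = v ^ (θ - 1) * (1 - v) ^ ((N : ℝ) - θ) / beta θ ((N : ℝ) - θ + 1) := by
  rw [betaDensity, betaPDFReal, if_pos ⟨h0, h1⟩]
  ring_nf

theorem beta_natCast_one {N : ℕ} (hN : 0 < N) : beta N 1 = 1 / N := by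
  have h : (N : ℝ) ≠ 0 := by positivity
  have := Real.Gamma_pos_of_pos (s := (N : ℝ)) (by positivity)
  rw [beta, Real.Gamma_add_one h, Real.Gamma_one]
  field_simp

theorem betaDensity_self {N : ℕ} {v : ℝ} (hN : 0 < N) (h0 : 0 < v) (h1 : v < 1) :
    betaDensity N N v = N * v ^ (N - 1) := by
  rw [betaDensity_eq h0 h1, sub_self, Real.rpow_zero, zero_add, beta_natCast_one hN,
    show (N : ℝ) - 1 = ((N - 1 : ℕ) : ℝ) by rw [Nat.cast_sub hN]; simp, Real.rpow_natCast]
  field_simp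

/-- The likelihood is the Beta density with the parameter `θ` truncated at `N`: at `θ = N` the Beta
density is `N v ^ (N - 1)`, the value of the likelihood for all `θ ≥ N`. -/
theorem betaLikelihood_eq_betaDensity {N : ℕ} {θ v : ℝ} (hN : 0 < N) (h0 : 0 < v) (h1 : v < 1) :
    betaLikelihood θ v N = betaDensity N (min θ N) v := by
  rw [betaLikelihood, if_neg (by rintro (h | h) <;> [exact h0.ne' h; omega])]
  split_ifs with h
  · rw [min_eq_left h.le, betaDensity_eq h0 h1]
  · rw [min_eq_right (not_lt.1 h), betaDensity_self hN h0 h1]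

theorem betaDensity_pos {N : ℕ} {θ v : ℝ} (hθ : 0 < θ) (hN : θ ≤ N) (h0 : 0 < v) (h1 : v < 1) :
    0 < betaDensity N θ v :=
  betaPDFReal_pos h0 h1 hθ (by linarith)

theorem log_betaDensity {N : ℕ} {θ v : ℝ} (hθ : 0 < θ) (hN : θ ≤ N) (h0 : 0 < v) (h1 : v < 1) :
    Real.log (betaDensity N θ v) = (θ - 1) * Real.log v + ((N : ℝ) - θ) * Real.log (1 - v) -
      (Real.log (Real.Gamma θ) + Real.log (Real.Gamma ((N : ℝ) - θ + 1)) -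
        Real.log (Real.Gamma ((N : ℝ) + 1))) := by
  have hv : 0 < 1 - v := by linarith
  have g1 := Real.Gamma_pos_of_pos hθ
  have g2 : 0 < Real.Gamma ((N : ℝ) - θ + 1) := Real.Gamma_pos_of_pos (by linarith)
  have g3 : 0 < Real.Gamma ((N : ℝ) + 1) := Real.Gamma_pos_of_pos (by positivity)
  rw [betaDensity_eq h0 h1, beta, show θ + ((N : ℝ) - θ + 1) = N + 1 by ring,
    Real.log_div (by positivity) (by positivity), Real.log_mul (by positivity) (by positivity),
    Real.log_rpow h0, Real.log_rpow hv, Real.log_div (by positivity) (by positivity),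
    Real.log_mul (by positivity) (by positivity)]

/-- Beta densities with `α + β` fixed form an exponential family, and `Γ` is log-convex. -/
theorem concaveOn_log_betaDensity (N : ℕ) {v : ℝ} (h0 : 0 < v) (h1 : v < 1) :
    ConcaveOn ℝ (Set.Ioc 0 (N : ℝ)) fun θ => Real.log (betaDensity N θ v) := by
  refine ⟨convex_Ioc _ _, fun x hx y hy a b ha hb hab => ?_⟩
  have hz := (convex_Ioc (0 : ℝ) N) hx hy ha hb hab
  have hG := Real.convexOn_log_Gamma.2
  have e1 := hG (Set.mem_Ioi.2 hx.1) (Set.mem_Ioi.2 hy.1) ha hb hab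
  have e2 := hG (x := (N : ℝ) - x + 1) (Set.mem_Ioi.2 (by linarith [hx.2]))
    (y := (N : ℝ) - y + 1) (Set.mem_Ioi.2 (by linarith [hy.2])) ha hb hab
  simp only [smul_eq_mul, Function.comp_apply] at *
  rw [log_betaDensity hx.1 hx.2 h0 h1, log_betaDensity hy.1 hy.2 h0 h1,
    log_betaDensity hz.1 hz.2 h0 h1]
  rw [show a * ((N : ℝ) - x + 1) + b * ((N : ℝ) - y + 1) = (N : ℝ) - (a * x + b * y) + 1 by
    linear_combination ((N : ℝ) + 1) * hab] at e2
  have hb' : b = 1 - a := by linarith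
  subst hb'
  nlinarith

/-- Extrapolation of a concave function beyond `θ₁`, away from `θ₀`. -/
theorem log_betaDensity_sub_le {N : ℕ} {v θ θ₀ θ₁ K : ℝ} (h0 : 0 < v) (h1 : v < 1)
    (hθ : θ ∈ Set.Ioc 0 (N : ℝ)) (hθ₀ : θ₀ ∈ Set.Ioc 0 (N : ℝ)) (hK : 1 ≤ K)
    (h : θ - θ₀ = K * (θ₁ - θ₀)) :
    Real.log (betaDensity N θ v) - Real.log (betaDensity N θ₀ v) ≤
      K * (Real.log (betaDensity N θ₁ v) - Real.log (betaDensity N θ₀ v)) := by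
  have hK0 : 0 < K := by linarith
  have := (concaveOn_log_betaDensity N h0 h1).2 hθ hθ₀ (show 0 ≤ 1 / K by positivity)
    (show 0 ≤ 1 - 1 / K by rw [sub_nonneg, div_le_one hK0]; exact hK) (by ring)
  simp only [smul_eq_mul] at this
  rw [show 1 / K * θ + (1 - 1 / K) * θ₀ = θ₁ by
    have : θ = θ₀ + K * (θ₁ - θ₀) := by linarith
    rw [this]; field_simp; ring] at this
  have h2 := mul_le_mul_of_nonneg_left this hK0.le
  have h3 : K * (1 / K * Real.log (betaDensity N θ v) +
      (1 - 1 / K) * Real.log (betaDensity N θ₀ v)) = Real.log (betaDensity N θ v) +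
      (K - 1) * Real.log (betaDensity N θ₀ v) := by field_simp
  rw [h3] at h2
  linarith

theorem lintegral_betaMeasure (α β : ℝ) (f : ℝ → ENNReal) :
    ∫⁻ v, f v ∂betaMeasure α β =
      ∫⁻ v in Set.Ioo 0 1, ENNReal.ofReal (betaPDFReal α β v) * f v := by
  have hm : Measurable (betaPDF α β) := (measurable_betaPDFReal α β).ennreal_ofReal
  rw [betaMeasure, lintegral_withDensity_eq_lintegral_mul_non_measurable _ hm (by simp [betaPDF]),
    ← lintegral_indicator measurableSet_Ioo]
  congr 1 with v
  simp only [Pi.mul_apply, Set.indicator_apply, Set.mem_Ioo, betaPDF]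
  split_ifs with h
  · rfl
  · simp [betaPDFReal, h]

theorem betaMeasure_compl_Ioo (α β : ℝ) : betaMeasure α β (Set.Ioo 0 1)ᶜ = 0 := by
  rw [← lintegral_indicator_one measurableSet_Ioo.compl, lintegral_betaMeasure,
    setLIntegral_eq_zero measurableSet_Ioo]
  intro v hv
  simp [hv.1, hv.2]

theorem measurable_betaDensity (N : ℕ) (θ : ℝ) : Measurable (betaDensity N θ) :=
  measurable_betaPDFReal _ _

theorem subsingleton_setOf_betaDensity_eq {N : ℕ} {θ₀ θ₁ : ℝ} (h₀ : θ₀ ∈ Set.Ioc 0 (N : ℝ))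
    (h₁ : θ₁ ∈ Set.Ioc 0 (N : ℝ)) (hne : θ₁ ≠ θ₀) :
    {v ∈ Set.Ioo (0 : ℝ) 1 | betaDensity N θ₁ v = betaDensity N θ₀ v}.Subsingleton := by
  have key : ∀ v ∈ {v ∈ Set.Ioo (0 : ℝ) 1 | betaDensity N θ₁ v = betaDensity N θ₀ v},
      ∀ w ∈ {v ∈ Set.Ioo (0 : ℝ) 1 | betaDensity N θ₁ v = betaDensity N θ₀ v}, ¬ v < w := by
    rintro v ⟨hv, ev⟩ w ⟨hw, ew⟩ hvw
    have ev' := congrArg Real.log ev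
    have ew' := congrArg Real.log ew
    rw [log_betaDensity h₀.1 h₀.2 hv.1 hv.2, log_betaDensity h₁.1 h₁.2 hv.1 hv.2] at ev'
    rw [log_betaDensity h₀.1 h₀.2 hw.1 hw.2, log_betaDensity h₁.1 h₁.2 hw.1 hw.2] at ew'
    have h : (θ₁ - θ₀) * ((Real.log w - Real.log v) +
        (Real.log (1 - v) - Real.log (1 - w))) = 0 := by
      linear_combination ew' - ev'
    have l1 := Real.log_lt_log hv.1 hvw
    have l2 := Real.log_lt_log (x := 1 - w) (y := 1 - v) (by linarith [hw.2]) (by linarith)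
    rcases mul_eq_zero.1 h with h | h
    · exact hne (by linarith)
    · linarith
  exact fun v hv w hw => le_antisymm (not_lt.1 (key w hw v hv)) (not_lt.1 (key v hv w hw))

/-- Two different Beta distributions have Hellinger affinity less than one. -/
theorem exists_lintegral_exp_log_ratio_le {N : ℕ} {θ₀ θ₁ : ℝ} (h₀ : θ₀ ∈ Set.Ioc 0 (N : ℝ))
    (h₁ : θ₁ ∈ Set.Ioc 0 (N : ℝ)) (hne : θ₁ ≠ θ₀) :
    ∃ c : ℝ, 0 < c ∧ ∫⁻ v, ENNReal.ofReal (Real.exp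
      ((Real.log (betaDensity N θ₁ v) - Real.log (betaDensity N θ₀ v)) / 2 + c))
        ∂betaMeasure θ₀ ((N : ℝ) - θ₀ + 1) ≤ 1 := by
  set B := betaMeasure θ₀ ((N : ℝ) - θ₀ + 1) with hB
  have : IsProbabilityMeasure B := isProbabilityMeasureBeta h₀.1 (by linarith [h₀.2])
  set r : ℝ → ℝ := fun v =>
    Real.exp ((Real.log (betaDensity N θ₁ v) - Real.log (betaDensity N θ₀ v)) / 2) with hr
  have m0 := measurable_betaDensity N θ₀
  have m1 := measurable_betaDensity N θ₁
  have hrm : Measurable r := by fun_prop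
  have hsq : ∀ v ∈ Set.Ioo (0 : ℝ) 1, r v ^ 2 = betaDensity N θ₁ v / betaDensity N θ₀ v := by
    intro v hv
    rw [hr]
    simp only
    rw [← Real.exp_nat_mul, Nat.cast_ofNat, mul_div_cancel₀ _ (by norm_num), Real.exp_sub,
      Real.exp_log (betaDensity_pos h₁.1 h₁.2 hv.1 hv.2),
      Real.exp_log (betaDensity_pos h₀.1 h₀.2 hv.1 hv.2)]
  have hr2 : ∫⁻ v, ENNReal.ofReal (r v ^ 2) ∂B = 1 := by
    rw [hB, lintegral_betaMeasure]
    have e : ∫⁻ v in Set.Ioo 0 1, ENNReal.ofReal (betaPDFReal θ₁ ((N : ℝ) - θ₁ + 1) v) = 1 := by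
      have := lintegral_betaMeasure θ₁ ((N : ℝ) - θ₁ + 1) (fun _ => 1)
      have : IsProbabilityMeasure (betaMeasure θ₁ ((N : ℝ) - θ₁ + 1)) :=
        isProbabilityMeasureBeta h₁.1 (by linarith [h₁.2])
      simp_all
    rw [← e]
    refine setLIntegral_congr_fun measurableSet_Ioo fun v hv => ?_
    have p0 := betaDensity_pos h₀.1 h₀.2 hv.1 hv.2
    rw [hsq v hv, ← ENNReal.ofReal_mul (by exact p0.le)]
    congr 1
    rw [show betaPDFReal θ₀ ((N : ℝ) - θ₀ + 1) v = betaDensity N θ₀ v from rfl]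
    rw [mul_div_cancel₀ _ p0.ne']
    rfl
  have hone : ∫⁻ v, ENNReal.ofReal ((1 + r v ^ 2) / 2) ∂B = 1 := by
    have e : ∀ v, ENNReal.ofReal ((1 + r v ^ 2) / 2) = (1 + ENNReal.ofReal (r v ^ 2)) / 2 := by
      intro v
      rw [ENNReal.ofReal_div_of_pos (by norm_num), ENNReal.ofReal_add (by norm_num) (by positivity)]
      simp
    simp_rw [e, div_eq_mul_inv]
    rw [lintegral_mul_const _ (by fun_prop), lintegral_add_left (by fun_prop), hr2]
    simp only [lintegral_const, measure_univ, mul_one]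
    rw [one_add_one_eq_two, ENNReal.mul_inv_cancel (by simp) (by simp)]
  have hae : ∀ᵐ v ∂B, ENNReal.ofReal (r v) < ENNReal.ofReal ((1 + r v ^ 2) / 2) := by
    have n1 : ∀ᵐ v ∂B, v ∈ Set.Ioo (0 : ℝ) 1 := betaMeasure_compl_Ioo _ _
    have n2 : ∀ᵐ v ∂B,
        v ∉ {v ∈ Set.Ioo (0 : ℝ) 1 | betaDensity N θ₁ v = betaDensity N θ₀ v} := by
      rw [ae_iff]
      simp only [not_not, Set.ofPred_mem_eq]
      exact withDensity_absolutelyContinuous _ _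
        ((subsingleton_setOf_betaDensity_eq h₀ h₁ hne).measure_zero _)
    filter_upwards [n1, n2] with v hv hv2
    have hr1 : r v ≠ 1 := by
      intro hc
      refine hv2 ⟨hv, ?_⟩
      have := hsq v hv
      rw [hc, one_pow, eq_div_iff (betaDensity_pos h₀.1 h₀.2 hv.1 hv.2).ne', one_mul] at this
      exact this.symm
    rw [ENNReal.ofReal_lt_ofReal_iff (by positivity)]
    nlinarith [sq_pos_of_ne_zero (sub_ne_zero.2 hr1)]
  have hlt : ∫⁻ v, ENNReal.ofReal (r v) ∂B < 1 := by
    rw [← hone]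
    refine lintegral_strict_mono (IsProbabilityMeasure.ne_zero B) (by fun_prop) ?_ hae
    refine ((lintegral_mono_ae (hae.mono fun _ h => h.le)).trans_lt ?_).ne
    rw [hone]
    exact ENNReal.one_lt_top
  set a := (∫⁻ v, ENNReal.ofReal (r v) ∂B).toReal with ha
  have ha0 : 0 ≤ a := ENNReal.toReal_nonneg
  have ha1 : a < 1 := by
    rw [ha, ← ENNReal.toReal_one]
    exact ENNReal.toReal_strict_mono ENNReal.one_ne_top hlt
  refine ⟨Real.log (2 / (1 + a)), Real.log_pos (by rw [lt_div_iff₀] <;> linarith), ?_⟩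
  have e : ∀ v, ENNReal.ofReal (Real.exp ((Real.log (betaDensity N θ₁ v) -
      Real.log (betaDensity N θ₀ v)) / 2 + Real.log (2 / (1 + a)))) =
      ENNReal.ofReal (r v) * ENNReal.ofReal (2 / (1 + a)) := by
    intro v
    rw [Real.exp_add, Real.exp_log (by positivity), ENNReal.ofReal_mul (by positivity)]
  simp_rw [e]
  rw [lintegral_mul_const _ (by fun_prop), ← ENNReal.ofReal_toReal hlt.ne_top, ← ha,
    ← ENNReal.ofReal_mul ha0, ← ENNReal.ofReal_one]
  apply ENNReal.ofReal_le_ofReal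
  rw [← mul_div_assoc, div_le_one (by positivity)]
  linarith

/-! ### The estimated confidence as a function of the complexity and of the sample size -/

/-- The confidence `∫₀^ε f_θ(v, N) dv` predicted by the complexity `θ`. -/
def modelConfidence (ε θ : ℝ) (N : ℕ) : ℝ :=
  ∫ v in (0 : ℝ)..ε, betaLikelihood θ v N

theorem modelConfidence_zero (ε θ : ℝ) : modelConfidence ε θ 0 = ε := by
  simp [modelConfidence, betaLikelihood]

theorem modelConfidence_eq_pow {ε θ : ℝ} {N : ℕ} (hN : 0 < N) (h : (N : ℝ) ≤ θ) :
    modelConfidence ε θ N = ε ^ N := by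
  have e : ∀ᵐ v : ℝ, v ∈ Set.uIoc 0 ε → betaLikelihood θ v N = N * v ^ (N - 1) := by
    have : ∀ᵐ v : ℝ, v ≠ 0 := by simp [ae_iff]
    filter_upwards [this] with v hv _
    rw [betaLikelihood, if_neg (by rintro (h | h) <;> [exact hv h; omega]), if_neg (not_lt.2 h)]
  rw [modelConfidence, intervalIntegral.integral_congr_ae e, intervalIntegral.integral_const_mul,
    integral_pow]
  have : N - 1 + 1 = N := by omega
  have h1 : ((N - 1 : ℕ) : ℝ) + 1 = N := by exact_mod_cast this
  rw [this, h1, zero_pow hN.ne', sub_zero, mul_div_cancel₀ _ (by positivity)]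

theorem modelConfidence_le {ε θ : ℝ} {N : ℕ} (h0 : 0 ≤ ε) (h1 : ε ≤ 1) (h : (N : ℝ) ≤ θ) :
    modelConfidence ε θ N ≤ ε := by
  rcases Nat.eq_zero_or_pos N with rfl | hN
  · rw [modelConfidence_zero]
  · rw [modelConfidence_eq_pow hN h]
    exact pow_le_of_le_one h0 h1 hN.ne'

theorem betaMeasure_real_Iic {ε θ : ℝ} {N : ℕ} (h0 : 0 < ε) (h1 : ε < 1) (hN : 0 < N)
    (hθ : 0 < θ) (h : θ ≤ N) :
    (betaMeasure θ ((N : ℝ) - θ + 1)).real (Set.Iic ε) = modelConfidence ε θ N := by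
  have e : betaMeasure θ ((N : ℝ) - θ + 1) (Set.Iic ε) =
      ∫⁻ v in Set.Ioc 0 ε, ENNReal.ofReal (betaDensity N θ v) := by
    rw [← lintegral_indicator_one measurableSet_Iic, lintegral_betaMeasure,
      ← lintegral_indicator measurableSet_Ioo, ← lintegral_indicator measurableSet_Ioc]
    congr 1 with v
    simp only [Set.indicator_apply, Set.mem_Ioo, Set.mem_Iic, Set.mem_Ioc, betaDensity,
      Pi.one_apply]
    by_cases hv : 0 < v ∧ v ≤ ε
    · rw [if_pos ⟨hv.1, hv.2.trans_lt h1⟩, if_pos hv.2, if_pos hv, mul_one]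
    · rw [if_neg hv]
      by_cases hv' : v ≤ ε
      · rw [if_neg fun h => hv ⟨h.1, hv'⟩]
      · rw [if_neg hv', mul_zero, ite_self]
  rw [measureReal_def, e, modelConfidence, intervalIntegral.integral_of_le h0.le,
    ← integral_eq_lintegral_of_nonneg_ae]
  · refine setIntegral_congr_fun measurableSet_Ioc fun v hv => ?_
    rw [betaLikelihood_eq_betaDensity hN hv.1 (hv.2.trans_lt h1), min_eq_left h]
  · refine (ae_restrict_iff' measurableSet_Ioc).2 (ae_of_all _ fun v hv => ?_)
    exact (betaDensity_pos hθ h hv.1 (hv.2.trans_lt h1)).le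
  · exact (measurable_betaDensity N θ).aestronglyMeasurable

/-- The mean of the Beta distribution. -/
theorem lintegral_ofReal_betaMeasure {θ : ℝ} {N : ℕ} (hθ : 0 < θ) (h : θ ≤ N) :
    ∫⁻ v, ENNReal.ofReal v ∂betaMeasure θ ((N : ℝ) - θ + 1) =
      ENNReal.ofReal (θ / ((N : ℝ) + 1)) := by
  have hb : 0 < (N : ℝ) - θ + 1 := by linarith
  have hP : IsProbabilityMeasure (betaMeasure (θ + 1) ((N : ℝ) - θ + 1)) :=
    isProbabilityMeasureBeta (by linarith) hb
  have e1 := lintegral_betaMeasure (θ + 1) ((N : ℝ) - θ + 1) (fun _ => 1)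
  simp only [lintegral_const, measure_univ, mul_one] at e1
  have hr : beta (θ + 1) ((N : ℝ) - θ + 1) = θ / ((N : ℝ) + 1) * beta θ ((N : ℝ) - θ + 1) := by
    have g : Real.Gamma ((N : ℝ) + 1) ≠ 0 := (Real.Gamma_pos_of_pos (by positivity)).ne'
    rw [beta, beta, Real.Gamma_add_one hθ.ne', show θ + 1 + ((N : ℝ) - θ + 1) = N + 1 + 1 by ring,
      show θ + ((N : ℝ) - θ + 1) = N + 1 by ring,
      Real.Gamma_add_one (s := (N : ℝ) + 1) (by positivity)]
    generalize Real.Gamma ((N : ℝ) - θ + 1) = x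
    field_simp
  rw [lintegral_betaMeasure, ← mul_one (ENNReal.ofReal (θ / ((N : ℝ) + 1))), e1,
    ← lintegral_const_mul _ (measurable_betaPDFReal _ _).ennreal_ofReal]
  refine setLIntegral_congr_fun measurableSet_Ioo fun v hv => ?_
  have hbp := beta_pos hθ hb
  rw [← ENNReal.ofReal_mul' hv.1.le, ← ENNReal.ofReal_mul (by positivity), betaPDFReal,
    betaPDFReal, if_pos ⟨hv.1, hv.2⟩, if_pos ⟨hv.1, hv.2⟩, hr, add_sub_cancel_right,
    show v ^ (θ + 1 - 1) = v ^ (θ - 1) * v by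
      rw [← Real.rpow_add_one hv.1.ne', sub_add_cancel, add_sub_cancel_right]]
  congr 1
  field_simp

theorem exists_le_modelConfidence {ε β θ : ℝ} (h0 : 0 < ε) (h1 : ε < 1) (hβ : β < 1)
    (hθ : 0 < θ) : ∃ N : ℕ, θ < N ∧ β ≤ modelConfidence ε θ N := by
  obtain ⟨N, hN⟩ := exists_nat_gt (max θ (θ / (ε * (1 - β))))
  have hN1 : θ < N := (le_max_left _ _).trans_lt hN
  have hN2 : θ / (ε * (1 - β)) < N := (le_max_right _ _).trans_lt hN
  have hb : 0 < 1 - β := by linarith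
  have hNp : 0 < N := by exact_mod_cast hθ.trans hN1
  refine ⟨N, hN1, ?_⟩
  set B := betaMeasure θ ((N : ℝ) - θ + 1) with hB
  have : IsProbabilityMeasure B := isProbabilityMeasureBeta hθ (by linarith)
  rw [← betaMeasure_real_Iic h0 h1 hNp hθ hN1.le, ← hB]
  have hM := meas_ge_le_lintegral_div (μ := B) (f := fun v => ENNReal.ofReal v)
    (by fun_prop) (ε := ENNReal.ofReal ε) (by simpa using h0) ENNReal.ofReal_ne_top
  rw [lintegral_ofReal_betaMeasure hθ hN1.le, ← ENNReal.ofReal_div_of_pos h0] at hM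
  have hsub : (Set.Iic ε)ᶜ ⊆ {v | ENNReal.ofReal ε ≤ ENNReal.ofReal v} := fun v hv =>
    ENNReal.ofReal_le_ofReal (le_of_lt (by simpa using hv))
  have h2 : B.real (Set.Iic ε)ᶜ ≤ θ / ((N : ℝ) + 1) / ε :=
    ENNReal.toReal_le_of_le_ofReal (by positivity) ((measure_mono hsub).trans hM)
  rw [probReal_compl_eq_one_sub measurableSet_Iic] at h2
  have h3 : θ / ((N : ℝ) + 1) / ε ≤ 1 - β := by
    rw [div_lt_iff₀ (by positivity)] at hN2
    rw [div_div, div_le_iff₀ (by positivity)]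
    nlinarith
  linarith

/-- For fixed complexity the predicted confidence increases with the sample size: the difference
of two consecutive Beta densities is the derivative of `N.choose (d-1) * v^d * (1-v)^(N-d+1)`. -/
theorem modelConfidence_lt_succ {ε : ℝ} {d N : ℕ} (h0 : 0 < ε) (h1 : ε < 1) (hd : 0 < d)
    (hN : d ≤ N) : modelConfidence ε d N < modelConfidence ε d (N + 1) := by
  obtain ⟨e, rfl⟩ : ∃ e, d = e + 1 := ⟨d - 1, by omega⟩
  obtain ⟨m, rfl⟩ : ∃ m, N = e + 1 + m := ⟨N - (e + 1), by omega⟩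
  have dens : ∀ k : ℕ, ∀ v ∈ Set.Ioc 0 ε, betaLikelihood ((e + 1 : ℕ) : ℝ) v (e + 1 + k) =
      ((e + 1 + k).factorial : ℝ) / (e.factorial * k.factorial) * (v ^ e * (1 - v) ^ k) := by
    intro k v hv
    have hv1 : v < 1 := hv.2.trans_lt h1
    rw [betaLikelihood_eq_betaDensity (by omega) hv.1 hv1,
      min_eq_left (by push_cast; linarith [k.cast_nonneg (α := ℝ)]),
      betaDensity_eq hv.1 hv1, beta]
    rw [show ((e + 1 : ℕ) : ℝ) - 1 = (e : ℕ) by push_cast; ring,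
      show ((e + 1 + k : ℕ) : ℝ) - ((e + 1 : ℕ) : ℝ) = (k : ℕ) by push_cast; ring,
      show ((e + 1 : ℕ) : ℝ) + ((k : ℝ) + 1) = ((e + 1 + k : ℕ) : ℝ) + 1 by push_cast; ring,
      Real.Gamma_nat_eq_factorial, Real.Gamma_nat_eq_factorial, Real.rpow_natCast,
      Real.rpow_natCast, show ((e + 1 : ℕ) : ℝ) = (e : ℝ) + 1 by push_cast; ring,
      Real.Gamma_nat_eq_factorial]
    have := Nat.factorial_pos e
    have := Nat.factorial_pos k
    have := Nat.factorial_pos (e + 1 + k)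
    field_simp
  have conf : ∀ k : ℕ, modelConfidence ε ((e + 1 : ℕ) : ℝ) (e + 1 + k) = ∫ v in (0 : ℝ)..ε,
      ((e + 1 + k).factorial : ℝ) / (e.factorial * k.factorial) * (v ^ e * (1 - v) ^ k) := by
    intro k
    refine intervalIntegral.integral_congr_ae (ae_of_all _ fun v hv => dens k v ?_)
    rwa [Set.uIoc_of_le h0.le] at hv
  rw [conf m, show e + 1 + m + 1 = e + 1 + (m + 1) by ring, conf (m + 1), ← sub_pos,
    ← intervalIntegral.integral_sub (Continuous.intervalIntegrable (by fun_prop) _ _)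
      (Continuous.intervalIntegrable (by fun_prop) _ _)]
  set C : ℝ := ((e + 1 + m).factorial : ℝ) / (e.factorial * (m + 1).factorial) with hC
  have hCpos : 0 < C := by positivity
  have hder : ∀ v ∈ Set.uIcc 0 ε, HasDerivAt (fun v : ℝ => C * (v ^ (e + 1) * (1 - v) ^ (m + 1)))
      (((e + 1 + (m + 1)).factorial : ℝ) / (e.factorial * (m + 1).factorial) *
        (v ^ e * (1 - v) ^ (m + 1)) -
      ((e + 1 + m).factorial : ℝ) / (e.factorial * m.factorial) * (v ^ e * (1 - v) ^ m)) v := by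
    intro v _
    have d1 := (hasDerivAt_id v).pow (e + 1)
    have d2 := ((hasDerivAt_id v).const_sub 1).pow (m + 1)
    refine ((d1.mul d2).const_mul C).congr_deriv ?_
    have f1 := Nat.factorial_pos e
    have f2 := Nat.factorial_pos m
    rw [hC, show e + 1 + (m + 1) = e + 1 + m + 1 by ring, Nat.factorial_succ (e + 1 + m),
      Nat.factorial_succ m]
    simp only [Nat.add_sub_cancel, id, Pi.pow_apply]
    push_cast
    field_simp
    ring
  rw [intervalIntegral.integral_eq_sub_of_hasDerivAt hder
    (Continuous.intervalIntegrable (by fun_prop) _ _)]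
  have : 0 < 1 - ε := by linarith
  simp only [ne_eq, Nat.add_eq_zero_iff, one_ne_zero, and_false, not_false_eq_true, zero_pow,
    zero_mul, mul_zero, sub_zero]
  positivity

theorem continuousAt_beta_sub {a θ : ℝ} (hθ : 0 < θ) (ha : θ < a) :
    ContinuousAt (fun θ => beta θ (a - θ)) θ := by
  have hG : ∀ s : ℝ, 0 < s → ContinuousAt Real.Gamma s := fun s hs =>
    (Real.differentiableAt_Gamma fun m => by
      have := m.cast_nonneg (α := ℝ); linarith).continuousAt
  have h1 : ContinuousAt (fun θ : ℝ => Real.Gamma (a - θ)) θ :=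
    ContinuousAt.comp (g := Real.Gamma) (hG _ (by linarith)) (by fun_prop)
  simp only [beta, add_sub_cancel]
  exact ((hG θ hθ).mul h1).div_const _

theorem continuousAt_betaDensity {N : ℕ} {θ v : ℝ} (hθ : 0 < θ) (hN : θ ≤ N) (h0 : 0 < v)
    (h1 : v < 1) : ContinuousAt (fun θ => betaDensity N θ v) θ := by
  have e : (fun θ => betaDensity N θ v) = fun θ =>
      v ^ (θ - 1) * (1 - v) ^ ((N : ℝ) - θ) / beta θ ((N : ℝ) - θ + 1) := by
    funext θ; exact betaDensity_eq h0 h1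
  have hv : 0 < 1 - v := by linarith
  rw [e]
  refine ContinuousAt.div ?_ ?_ (beta_pos hθ (by linarith)).ne'
  · exact ((continuousAt_const.rpow (by fun_prop) (Or.inl h0.ne')).mul
      (continuousAt_const.rpow (by fun_prop) (Or.inl hv.ne')))
  · simp_rw [sub_add_eq_add_sub]
    exact continuousAt_beta_sub hθ (by linarith)

theorem measurable_betaLikelihood (θ : ℝ) (N : ℕ) : Measurable fun v => betaLikelihood θ v N := by
  unfold betaLikelihood
  refine Measurable.ite ?_ measurable_const ?_
  · by_cases hN : N = 0
    · simp [hN]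
    · simp [hN]
  · split_ifs <;> fun_prop

theorem continuousAt_modelConfidence {ε : ℝ} {d N : ℕ} (h0 : 0 < ε) (h1 : ε < 1) (hd : 0 < d)
    (hN : d ≤ N) : ContinuousAt (fun θ => modelConfidence ε θ N) d := by
  have hNp : 0 < N := by omega
  have hdR : (1 : ℝ) ≤ d := by exact_mod_cast hd
  have hdN : (d : ℝ) ≤ N := by exact_mod_cast hN
  have hmin : min (d : ℝ) N = d := min_eq_left hdN
  have cmin : ContinuousAt (fun θ : ℝ => min θ (N : ℝ)) d := by fun_prop
  have cbeta : ContinuousAt (fun θ : ℝ => 1 / beta (min θ (N : ℝ)) ((N : ℝ) + 1 - min θ (N : ℝ)))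
      d := by
    refine continuousAt_const.div (ContinuousAt.comp (f := fun θ : ℝ => min θ (N : ℝ))
      (g := fun θ : ℝ => beta θ ((N : ℝ) + 1 - θ)) ?_ cmin) ?_
    · rw [hmin]
      exact continuousAt_beta_sub (by linarith) (by linarith)
    · rw [hmin]
      exact (beta_pos (by linarith) (by linarith)).ne'
  set C := 1 / beta (min (d : ℝ) N) ((N : ℝ) + 1 - min (d : ℝ) N) + 1 with hC
  have evC := cbeta.eventually_lt_const (show _ < C by rw [hC]; linarith)
  have evm := cmin.eventually_const_lt (show (d : ℝ) - 1 / 2 < min (d : ℝ) N by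
    rw [hmin]; linarith)
  refine intervalIntegral.continuousAt_of_dominated_interval
    (bound := fun v => C * v ^ (-(1 / 2) : ℝ)) ?_ ?_ ?_ ?_
  · exact Eventually.of_forall fun θ => (measurable_betaLikelihood θ N).aestronglyMeasurable
  · filter_upwards [evC, evm] with θ hθ hm
    refine ae_of_all _ fun v hv => ?_
    rw [Set.uIoc_of_le h0.le] at hv
    have hv1 : v < 1 := hv.2.trans_lt h1
    have hmN : min θ (N : ℝ) ≤ N := min_le_right _ _
    have hm0 : 0 < min θ (N : ℝ) := by linarith
    have hb := beta_pos hm0 (show 0 < (N : ℝ) + 1 - min θ (N : ℝ) by linarith)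
    rw [betaLikelihood_eq_betaDensity hNp hv.1 hv1,
      Real.norm_of_nonneg (betaDensity_pos hm0 hmN hv.1 hv1).le, betaDensity_eq hv.1 hv1,
      sub_add_eq_add_sub, div_eq_mul_one_div, mul_comm]
    refine mul_le_mul hθ.le ?_ (mul_nonneg (Real.rpow_nonneg hv.1.le _)
      (Real.rpow_nonneg (by linarith) _)) ((one_div_pos.2 hb).le.trans hθ.le)
    calc v ^ (min θ (N : ℝ) - 1) * (1 - v) ^ ((N : ℝ) - min θ (N : ℝ))
        ≤ v ^ (-(1 / 2) : ℝ) * 1 := by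
          refine mul_le_mul (Real.rpow_le_rpow_of_exponent_ge hv.1 hv1.le (by linarith))
            (Real.rpow_le_one (by linarith) (by linarith [hv.1]) (by linarith))
            (Real.rpow_nonneg (by linarith) _) (Real.rpow_nonneg hv.1.le _)
      _ = _ := mul_one _
  · exact (intervalIntegral.intervalIntegrable_rpow' (by norm_num)).const_mul _
  · refine ae_of_all _ fun v hv => ?_
    rw [Set.uIoc_of_le h0.le] at hv
    have hv1 : v < 1 := hv.2.trans_lt h1
    simp_rw [betaLikelihood_eq_betaDensity hNp hv.1 hv1]
    refine ContinuousAt.comp (f := fun θ : ℝ => min θ (N : ℝ))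
      (g := fun θ : ℝ => betaDensity N θ v) ?_ cmin
    rw [hmin]
    exact continuousAt_betaDensity (by linarith) hdN hv.1 hv1

theorem le_modelConfidence_sizeEstimate {ε β θ : ℝ} (h0 : 0 < ε) (hεβ : ε < β) (hβ : β < 1)
    (hθ : 0 < θ) : β ≤ modelConfidence ε θ (sizeEstimate θ ε β) := by
  obtain ⟨N, -, hN⟩ := exists_le_modelConfidence h0 (hεβ.trans hβ) hβ hθ
  exact Nat.sInf_mem (s := {N | β ≤ modelConfidence ε θ N}) ⟨N, hN⟩

theorem sizeEstimate_le {ε β θ : ℝ} {N : ℕ} (h : β ≤ modelConfidence ε θ N) :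
    sizeEstimate θ ε β ≤ N :=
  Nat.sInf_le h

theorem lt_sizeEstimate {ε β θ : ℝ} (h0 : 0 < ε) (hεβ : ε < β) (hβ : β < 1) (hθ : 0 < θ) :
    θ < sizeEstimate θ ε β := by
  by_contra! h
  have := le_modelConfidence_sizeEstimate h0 hεβ hβ hθ
  linarith [modelConfidence_le h0.le (hεβ.trans hβ).le h]

theorem eventually_le_sizeEstimate {ε β : ℝ} {d M : ℕ} (h0 : 0 < ε) (hεβ : ε < β) (hβ : β < 1)
    (hd : 0 < d) (hM : ∀ N < M, modelConfidence ε d N < β) :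
    ∀ᶠ θ in 𝓝 (d : ℝ), M ≤ sizeEstimate θ ε β := by
  have hev : ∀ N ∈ Set.Iio M, ∀ᶠ θ in 𝓝 (d : ℝ), modelConfidence ε θ N < β := by
    intro N hN
    rcases le_or_gt d N with h | h
    · exact (continuousAt_modelConfidence h0 (hεβ.trans hβ) hd h).eventually_lt_const (hM N hN)
    · filter_upwards [lt_mem_nhds (show (N : ℝ) < d by exact_mod_cast h)] with θ hθ
      exact (modelConfidence_le h0.le (hεβ.trans hβ).le hθ.le).trans_lt hεβ
  filter_upwards [(eventually_all_finite (Set.finite_Iio M)).2 hev,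
    lt_mem_nhds (show (0 : ℝ) < d by exact_mod_cast hd)] with θ hθ hpos
  by_contra! h
  exact (hθ _ h).not_ge (le_modelConfidence_sizeEstimate h0 hεβ hβ hpos)

theorem modelConfidence_lt_of_le {ε β : ℝ} {d N : ℕ} (h0 : 0 < ε) (hεβ : ε < β) (hβ : β < 1)
    (hN : N ≤ d) : modelConfidence ε d N < β :=
  (modelConfidence_le h0.le (hεβ.trans hβ).le (by exact_mod_cast hN)).trans_lt hεβ

/-- Equality `modelConfidence ε d M = β` is possible, in which case the size estimate may jump
to `M + 1` for `θ` arbitrarily close to `d`. -/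
theorem eventually_sizeEstimate_mem {ε β : ℝ} {d M : ℕ} (h0 : 0 < ε) (hεβ : ε < β) (hβ : β < 1)
    (hd : 0 < d) (hdM : d ≤ M) (hM : ∀ N < M, modelConfidence ε d N < β)
    (hM' : β ≤ modelConfidence ε d M) :
    ∀ᶠ θ in 𝓝 (d : ℝ), sizeEstimate θ ε β ∈ Set.Icc M (M + 1) := by
  have h1 := hεβ.trans hβ
  filter_upwards [eventually_le_sizeEstimate h0 hεβ hβ hd hM,
    (continuousAt_modelConfidence h0 h1 hd (hdM.trans M.le_succ)).eventually_const_lt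
      (hM'.trans_lt (modelConfidence_lt_succ h0 h1 hd hdM))] with θ hθ hθ'
  exact ⟨hθ, sizeEstimate_le hθ'.le⟩

/-! ### Moments determine a distribution on the unit interval -/

/-- The Hausdorff moment problem on `[0, 1]` is determinate. -/
theorem ext_of_integral_one_sub_pow_eq {μ ν : Measure ℝ} [IsProbabilityMeasure μ]
    [IsProbabilityMeasure ν] (hμ : ∀ᵐ v ∂μ, v ∈ Set.Icc (0 : ℝ) 1)
    (hν : ∀ᵐ v ∂ν, v ∈ Set.Icc (0 : ℝ) 1)
    (h : ∀ k : ℕ, ∫ v, (1 - v) ^ k ∂μ = ∫ v, (1 - v) ^ k ∂ν) : μ = ν := by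
  have hint : ∀ (ρ : Measure ℝ) [IsProbabilityMeasure ρ], (∀ᵐ v ∂ρ, v ∈ Set.Icc (0 : ℝ) 1) →
      ∀ f : ℝ → ℝ, Continuous f → Integrable f ρ := by
    intro ρ _ hρ f hf
    obtain ⟨C, hC⟩ := isCompact_Icc.exists_bound_of_continuousOn (s := Set.Icc (0 : ℝ) 1)
      hf.continuousOn
    exact Integrable.of_bound hf.aestronglyMeasurable C (hρ.mono hC)
  have hpoly : ∀ p : Polynomial ℝ, ∫ v, p.eval (1 - v) ∂μ = ∫ v, p.eval (1 - v) ∂ν := by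
    intro p
    induction p using Polynomial.induction_on' with
    | add p q hp hq =>
      simp only [Polynomial.eval_add]
      rw [integral_add (hint μ hμ _ (by fun_prop)) (hint μ hμ _ (by fun_prop)),
        integral_add (hint ν hν _ (by fun_prop)) (hint ν hν _ (by fun_prop)), hp, hq]
    | monomial n a =>
      simp only [Polynomial.eval_monomial, integral_const_mul, h n]
  refine ext_of_forall_integral_eq_of_IsFiniteMeasure fun f => ?_
  by_contra hne
  set δ := |∫ v, f v ∂μ - ∫ v, f v ∂ν| with hδ
  have hδ0 : 0 < δ := abs_pos.2 (sub_ne_zero.2 hne)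
  obtain ⟨p, hp⟩ := exists_polynomial_near_of_continuousOn 0 1 (fun u => f (1 - u))
    (by fun_prop) (δ / 3) (by positivity)
  have near : ∀ (ρ : Measure ℝ) [IsProbabilityMeasure ρ], (∀ᵐ v ∂ρ, v ∈ Set.Icc (0 : ℝ) 1) →
      |∫ v, p.eval (1 - v) ∂ρ - ∫ v, f v ∂ρ| ≤ δ / 3 := by
    intro ρ _ hρ
    rw [← integral_sub (hint ρ hρ _ (by fun_prop)) (hint ρ hρ _ f.continuous)]
    have := norm_integral_le_of_norm_le_const (μ := ρ) (C := δ / 3)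
      (f := fun v => p.eval (1 - v) - f v) (hρ.mono fun v hv => by
        have := hp (1 - v) ⟨by linarith [hv.2], by linarith [hv.1]⟩
        rw [sub_sub_cancel] at this
        exact this.le)
    simpa using this
  have h1 := near μ hμ
  have h2 := near ν hν
  rw [hpoly] at h1
  have h3 := abs_sub_le (∫ v, f v ∂μ) (∫ v, p.eval (1 - v) ∂ν) (∫ v, f v ∂ν)
  rw [abs_sub_comm (∫ v, f v ∂μ) (∫ v, p.eval (1 - v) ∂ν)] at h3
  linarith

/-- Weighting `Beta (d, 1)` by `(1 - v) ^ k` gives a multiple of `Beta (d, k + 1)`. -/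
theorem choose_mul_lintegral_betaMeasure {d : ℕ} (hd : 0 < d) (k : ℕ) {φ : ℝ → ENNReal} :
    ((d + k).choose d : ENNReal) *
        ∫⁻ v, φ v * ENNReal.ofReal ((1 - v) ^ k) ∂betaMeasure d 1 =
      ∫⁻ v, φ v ∂betaMeasure d (k + 1) := by
  rw [lintegral_betaMeasure, lintegral_betaMeasure, ← lintegral_const_mul' _ _ (by simp)]
  refine setLIntegral_congr_fun measurableSet_Ioo fun v hv => ?_
  obtain ⟨e, rfl⟩ : ∃ e, d = e + 1 := ⟨d - 1, by omega⟩
  have hv1 : 0 < 1 - v := by linarith [hv.2]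
  have hc : ((e + 1 + k).choose (e + 1) : ℝ) * (betaPDFReal ((e + 1 : ℕ) : ℝ) 1 v * (1 - v) ^ k) =
      betaPDFReal ((e + 1 : ℕ) : ℝ) (k + 1) v := by
    rw [betaPDFReal, betaPDFReal, if_pos ⟨hv.1, hv.2⟩, if_pos ⟨hv.1, hv.2⟩, beta_natCast_one hd,
      beta, sub_self, Real.rpow_zero, add_sub_cancel_right, Real.rpow_natCast,
      show ((e + 1 : ℕ) : ℝ) + ((k : ℝ) + 1) = ((e + 1 + k : ℕ) : ℝ) + 1 by push_cast; ring,
      Real.Gamma_nat_eq_factorial, Real.Gamma_nat_eq_factorial,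
      show ((e + 1 : ℕ) : ℝ) = (e : ℝ) + 1 by push_cast; ring, Real.Gamma_nat_eq_factorial,
      Nat.cast_add_choose, Nat.factorial_succ e]
    have := Nat.factorial_pos e
    have := Nat.factorial_pos k
    push_cast
    field_simp
  rw [← hc, ENNReal.ofReal_mul (by positivity), ENNReal.ofReal_mul' (by positivity),
    ENNReal.ofReal_natCast]
  ring

/-! ### The law of the risk under fixed complexity -/

section Law

variable {X : Type*} {G : Set (X → ℝ)}

theorem IsUniqueSolution.eq {J : X → ℝ} {M N : ℕ} {g : Fin M → G} {h : Fin N → G} {x y : X}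
    (hx : IsUniqueSolution J g x) (hy : IsUniqueSolution J h y) (hxh : Feasible h x)
    (hyg : Feasible g y) : x = y := by
  by_contra hne
  exact lt_asymm (hx.2 y hyg (Ne.symm hne)) (hy.2 x hxh hne)

variable [MeasurableSpace G] {P : Measure G} [IsProbabilityMeasure P]
  {A : (N : ℕ) → (Fin N → G) → X} {J : X → ℝ} {d : ℕ}

instance (N : ℕ) : IsProbabilityMeasure (sampleLaw P N) := by
  unfold sampleLaw; infer_instance

theorem measurableSet_violation (hmeas : MeasurableViolation A) {N : ℕ} (g : Fin N → G) :
    MeasurableSet {h : G | 0 < (h : X → ℝ) (A N g)} :=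
  measurable_prodMk_left (hmeas N)

theorem measurable_risk (hmeas : MeasurableViolation A) (N : ℕ) :
    Measurable fun g : Fin N → G => risk P (A N g) :=
  (measurable_measure_prodMk_left (hmeas N)).ennreal_toReal

theorem risk_mem_Icc (x : X) : risk P x ∈ Set.Icc (0 : ℝ) 1 :=
  ⟨measureReal_nonneg, measureReal_le_one⟩

/-- Splitting a sample into two independent samples along `e : Fin m ⊕ Fin k ≃ Fin N`. -/
theorem measurePreserving_split {m k N : ℕ} (e : Fin m ⊕ Fin k ≃ Fin N) :
    MeasurePreserving
      (fun g : Fin N → G => ((fun i => g (e (.inl i))), (fun j => g (e (.inr j)))))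
      (sampleLaw P N) ((sampleLaw P m).prod (sampleLaw P k)) := by
  have h1 := (measurePreserving_piCongrLeft (α := fun _ : Fin N => G) (fun _ => P) e).symm
  have h2 := measurePreserving_sumPiEquivProdPi (X := fun _ : Fin m ⊕ Fin k => G) (fun _ => P)
  exact h2.comp h1

theorem measurePreserving_comp_inl {m k N : ℕ} (e : Fin m ⊕ Fin k ≃ Fin N) :
    MeasurePreserving (fun (g : Fin N → G) i => g (e (.inl i))) (sampleLaw P N) (sampleLaw P m) :=
  measurePreserving_fst.comp (measurePreserving_split e)

theorem sampleLaw_feasible (hmeas : MeasurableViolation A) {m : ℕ} (g : Fin m → G) (k : ℕ) :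
    sampleLaw P k {h | Feasible h (A m g)} = ENNReal.ofReal ((1 - risk P (A m g)) ^ k) := by
  have e : {h : Fin k → G | Feasible h (A m g)} =
      Set.univ.pi fun _ => {h : G | 0 < (h : X → ℝ) (A m g)}ᶜ := by
    ext h; simp [Feasible, Set.mem_pi]
  rw [e, sampleLaw, Measure.pi_pi, Finset.prod_const, Finset.card_univ, Fintype.card_fin,
    ENNReal.ofReal_pow (sub_nonneg.2 (risk_mem_Icc _).2),
    ← ofReal_measureReal, probReal_compl_eq_one_sub (measurableSet_violation hmeas g)]
  rfl

/-- The event that the solution of the first block of constraints satisfies the second block. -/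
theorem measurableSet_feasible_split (hmeas : MeasurableViolation A) (m k : ℕ) :
    MeasurableSet {p : (Fin m → G) × (Fin k → G) | Feasible p.2 (A m p.1)} := by
  have e : {p : (Fin m → G) × (Fin k → G) | Feasible p.2 (A m p.1)} =
      ⋂ j, (fun p : (Fin m → G) × (Fin k → G) => (p.1, p.2 j)) ⁻¹'
        {p : (Fin m → G) × G | 0 < (p.2 : X → ℝ) (A m p.1)}ᶜ := by
    ext p; simp [Feasible]
  rw [e]
  exact MeasurableSet.iInter fun j =>
    (show Measurable _ by fun_prop) (hmeas m).compl

theorem lintegral_indicator_feasible (hmeas : MeasurableViolation A) {m k N : ℕ}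
    (e : Fin m ⊕ Fin k ≃ Fin N) {φ : ℝ → ENNReal} (hφ : Measurable φ) :
    ∫⁻ g, {g : Fin N → G |
        Feasible (fun j => g (e (.inr j))) (A m fun i => g (e (.inl i)))}.indicator
      (fun g => φ (risk P (A m fun i => g (e (.inl i))))) g ∂sampleLaw P N =
    ∫⁻ g, φ (risk P (A m g)) * ENNReal.ofReal ((1 - risk P (A m g)) ^ k) ∂sampleLaw P m := by
  set S := {p : (Fin m → G) × (Fin k → G) | Feasible p.2 (A m p.1)} with hS
  have hSm : MeasurableSet S := measurableSet_feasible_split hmeas m k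
  have hr := (measurable_risk (P := P) hmeas m)
  have hF : Measurable (S.indicator fun p => φ (risk P (A m p.1))) :=
    (hφ.comp (hr.comp measurable_fst)).indicator hSm
  have h1 := (measurePreserving_split (P := P) e).lintegral_comp hF
  rw [lintegral_prod _ hF.aemeasurable] at h1
  refine Eq.trans ?_ (h1.trans (lintegral_congr fun g => ?_))
  · rfl
  · have e2 : ∀ y, S.indicator (fun p => φ (risk P (A m p.1))) (g, y) =
        φ (risk P (A m g)) * {h : Fin k → G | Feasible h (A m g)}.indicator 1 y := by
      intro y
      by_cases hy : Feasible y (A m g) <;> simp [hS, hy, Set.indicator]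
    have hm2 : MeasurableSet {h : Fin k → G | Feasible h (A m g)} :=
      measurable_prodMk_left hSm
    simp_rw [e2]
    rw [lintegral_const_mul _ (measurable_one.indicator hm2), lintegral_indicator_one hm2,
      sampleLaw_feasible hmeas]

theorem exists_sum_equiv {m k : ℕ} (i : Fin m ↪o Fin (m + k)) :
    ∃ e : Fin m ⊕ Fin k ≃ Fin (m + k), ∀ l, e (.inl l) = i l := by
  have hc : (Finset.univ.map i.toEmbedding).card = m := by simp
  refine ⟨finSumEquivOfFinset hc
    (by rw [Finset.card_compl, hc, Fintype.card_fin, Nat.add_sub_cancel_left]), fun k => ?_⟩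
  rw [finSumEquivOfFinset_inl, ← Finset.orderEmbOfFin_unique' hc (f := i) (by simp)]

theorem card_fin_orderEmbedding (d N : ℕ) : Fintype.card (Fin d ↪o Fin N) = N.choose d := by
  rw [← Nat.card_eq_fintype_card, Nat.card_congr Set.powersetCard.ofFinEmbEquiv,
    Set.powersetCard.card, Nat.card_fin]

/-- Almost surely exactly one sub-sample of size `d` has a solution which satisfies the other
constraints, and this solution is the solution for the whole sample. -/
theorem lintegral_risk_eq_choose_mul (hA : IsScenarioSolution J P A) (hmeas : MeasurableViolation A)
    (hfix : HasFixedComplexity P A d) (k : ℕ) {φ : ℝ → ENNReal} (hφ : Measurable φ) :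
    ∫⁻ g, φ (risk P (A (d + k) g)) ∂sampleLaw P (d + k) = ((d + k).choose d : ENNReal) *
      ∫⁻ g, φ (risk P (A d g)) * ENNReal.ofReal ((1 - risk P (A d g)) ^ k) ∂sampleLaw P d := by
  classical
  choose e he using fun i : Fin d ↪o Fin (d + k) => exists_sum_equiv i
  set S : (Fin d ↪o Fin (d + k)) → Set (Fin (d + k) → G) := fun i =>
    {g | Feasible (fun j => g (e i (.inr j))) (A d fun l => g (e i (.inl l)))} with hS
  have hSm : ∀ i, MeasurableSet (S i) := fun i =>
    (measurePreserving_split (P := P) (e i)).measurable (measurableSet_feasible_split hmeas d k)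
  have hsub : ∀ᵐ g ∂sampleLaw P (d + k), ∀ i : Fin d ↪o Fin (d + k),
      IsUniqueSolution J (fun l => g (e i (.inl l))) (A d fun l => g (e i (.inl l))) :=
    ae_all_iff.2 fun i =>
      (measurePreserving_comp_inl (P := P) (e i)).quasiMeasurePreserving.ae (hA d)
  have hsum : ∀ᵐ g ∂sampleLaw P (d + k), φ (risk P (A (d + k) g)) =
      ∑ i, (S i).indicator (fun g => φ (risk P (A d fun l => g (e i (.inl l))))) g := by
    filter_upwards [hA (d + k), hsub, hfix (d + k) (Nat.le_add_right d k)] with g h1 h2 h3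
    have hiff : ∀ i, g ∈ S i ↔ A (d + k) g = A d fun l => g (i l) := by
      intro i
      simp_rw [← he i]
      refine ⟨fun hi => h1.eq (h2 i) (fun l => h1.1 _) fun n => ?_, fun hi j => ?_⟩
      · obtain ⟨s | s, rfl⟩ := (e i).surjective n
        · exact (h2 i).1 s
        · exact hi s
      · rw [← hi]
        exact h1.1 _
    obtain ⟨i₀, hi₀, huniq⟩ := h3
    rw [Finset.sum_eq_single i₀, Set.indicator_of_mem ((hiff i₀).2 hi₀)]
    · simp_rw [he i₀, ← hi₀]
    · exact fun i _ hi => Set.indicator_of_notMem (fun h => hi (huniq i ((hiff i).1 h))) _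
    · simp
  have hr : ∀ i, Measurable ((S i).indicator
      (fun g : Fin (d + k) → G => φ (risk P (A d fun l => g (e i (.inl l)))))) := fun i =>
    (hφ.comp ((measurable_risk hmeas d).comp (by fun_prop))).indicator (hSm i)
  rw [lintegral_congr_ae hsum, lintegral_finsetSum _ fun i _ => hr i]
  simp_rw [hS, lintegral_indicator_feasible hmeas _ hφ]
  rw [Finset.sum_const, Finset.card_univ, card_fin_orderEmbedding, nsmul_eq_mul]

/-- The risk of the solution computed from `d` constraints follows `Beta (d, 1)`: its moments are
the reciprocals of binomial coefficients. -/
theorem map_risk_self (hA : IsScenarioSolution J P A) (hmeas : MeasurableViolation A)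
    (hfix : HasFixedComplexity P A d) (hd : 0 < d) :
    (sampleLaw P d).map (fun g => risk P (A d g)) = betaMeasure d 1 := by
  have hr := measurable_risk (P := P) hmeas d
  have hdR : (0 : ℝ) < d := by exact_mod_cast hd
  have : IsProbabilityMeasure (betaMeasure d 1) := isProbabilityMeasureBeta hdR one_pos
  have : IsProbabilityMeasure ((sampleLaw P d).map fun g => risk P (A d g)) :=
    Measure.isProbabilityMeasure_map hr.aemeasurable
  have h1 : ∀ᵐ v ∂(sampleLaw P d).map (fun g => risk P (A d g)), v ∈ Set.Icc (0 : ℝ) 1 :=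
    (ae_map_iff hr.aemeasurable measurableSet_Icc).2 (ae_of_all _ fun g => risk_mem_Icc _)
  have h2 : ∀ᵐ v ∂betaMeasure d 1, v ∈ Set.Icc (0 : ℝ) 1 := by
    have : ∀ᵐ v ∂betaMeasure d 1, v ∈ Set.Ioo (0 : ℝ) 1 := betaMeasure_compl_Ioo _ _
    exact this.mono fun v hv => Set.Ioo_subset_Icc_self hv
  refine ext_of_integral_one_sub_pow_eq h1 h2 fun k => ?_
  have m1 : ∫⁻ v, ENNReal.ofReal ((1 - v) ^ k) ∂(sampleLaw P d).map (fun g => risk P (A d g)) =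
      ∫⁻ v, ENNReal.ofReal ((1 - v) ^ k) ∂betaMeasure d 1 := by
    have e1 := lintegral_risk_eq_choose_mul hA hmeas hfix k (φ := fun _ => 1) measurable_const
    have e2 := choose_mul_lintegral_betaMeasure hd k (φ := fun _ => 1)
    have : IsProbabilityMeasure (betaMeasure d (k + 1)) :=
      isProbabilityMeasureBeta hdR (by positivity)
    simp only [lintegral_const, measure_univ, mul_one, one_mul] at e1 e2
    rw [lintegral_map (by fun_prop) hr]
    have hc : ((d + k).choose d : ENNReal) ≠ 0 := by
      exact_mod_cast (Nat.choose_pos (Nat.le_add_right d k)).ne'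
    exact (ENNReal.mul_right_inj hc (by simp)).1 (e1.symm.trans e2.symm)
  have pos : ∀ v ∈ Set.Icc (0 : ℝ) 1, 0 ≤ (1 - v) ^ k := fun v hv =>
    pow_nonneg (by linarith [hv.2]) k
  rw [integral_eq_lintegral_of_nonneg_ae (h1.mono pos) (by fun_prop),
    integral_eq_lintegral_of_nonneg_ae (h2.mono pos) (by fun_prop), m1]

/-- **Campi–Garatti**: under fixed complexity `d` the risk of the solution computed from `N ≥ d`
constraints follows `Beta (d, N - d + 1)`. -/
theorem map_risk (hA : IsScenarioSolution J P A) (hmeas : MeasurableViolation A)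
    (hfix : HasFixedComplexity P A d) (hd : 0 < d) {N : ℕ} (hN : d ≤ N) :
    (sampleLaw P N).map (fun g => risk P (A N g)) = betaMeasure d ((N : ℝ) - d + 1) := by
  obtain ⟨k, rfl⟩ := Nat.exists_eq_add_of_le hN
  have hr := measurable_risk (P := P) hmeas (d + k)
  have hrd := measurable_risk (P := P) hmeas d
  refine Measure.ext_of_lintegral _ fun φ hφ => ?_
  rw [lintegral_map hφ hr, lintegral_risk_eq_choose_mul hA hmeas hfix k hφ,
    show ((d + k : ℕ) : ℝ) - d + 1 = k + 1 by push_cast; ring,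
    ← choose_mul_lintegral_betaMeasure hd, ← map_risk_self hA hmeas hfix hd,
    lintegral_map (by fun_prop) hrd]

/-- With fewer than `d` constraints the solution is violated almost surely: otherwise the solution
of the first `N` among `d + 1` constraints could satisfy all of them, and leaving out either of
the last two constraints would not change the solution. -/
theorem ae_risk_eq_one (hA : IsScenarioSolution J P A) (hmeas : MeasurableViolation A)
    (hfix : HasFixedComplexity P A d) {N : ℕ} (hN : N < d) :
    ∀ᵐ g ∂sampleLaw P N, risk P (A N g) = 1 := by
  obtain ⟨k, rfl⟩ := Nat.exists_eq_add_of_lt hN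
  set d := N + k + 1 with hd
  let e : Fin N ⊕ Fin (k + 2) ≃ Fin (d + 1) := finSumFinEquiv
  have hel : ∀ l, (e (.inl l) : ℕ) = l := fun l => rfl
  have hleave : ∀ᵐ g ∂sampleLaw P (d + 1), ∀ p : Fin (d + 1),
      IsUniqueSolution J (fun l => g (p.succAbove l)) (A d fun l => g (p.succAbove l)) := by
    refine ae_all_iff.2 fun p => ?_
    obtain ⟨e', he'⟩ := exists_sum_equiv (k := 1) (Fin.succAboveOrderEmb p)
    have := (measurePreserving_comp_inl (P := P) e').quasiMeasurePreserving.ae (hA d)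
    simp only [he'] at this
    exact this
  have hfirst := (measurePreserving_comp_inl (P := P) e).quasiMeasurePreserving.ae (hA N)
  have hnot : ∀ᵐ g ∂sampleLaw P (d + 1),
      ¬ Feasible (fun j => g (e (.inr j))) (A N fun i => g (e (.inl i))) := by
    filter_upwards [hleave, hfirst, hA (d + 1), hfix (d + 1) d.le_succ] with g h1 h2 h3 h4 hfeas
    have hall : Feasible g (A N fun i => g (e (.inl i))) := by
      intro n
      obtain ⟨s | s, rfl⟩ := e.surjective n
      · exact h2.1 s
      · exact hfeas s
    have hq : ∀ p : Fin (d + 1), N ≤ (p : ℕ) → A (d + 1) g = A d fun l => g (p.succAbove l) := by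
      intro p hp
      have e1 := h3.eq h2 (fun i => h3.1 _) hall
      have e2 := h2.eq (h1 p) (fun l => hall _) fun i => by
        have hne : e (.inl i) ≠ p := fun h => by
          have := hel i
          rw [h] at this
          omega
        obtain ⟨l, hl⟩ := Fin.exists_succAbove_eq hne
        have hf := (h1 p).1 l
        simp only [hl] at hf
        exact hf
      exact e1.trans e2
    have hlast := h4.unique (y₁ := Fin.succAboveOrderEmb ⟨d, by omega⟩)
      (y₂ := Fin.succAboveOrderEmb ⟨d - 1, by omega⟩)
      (hq ⟨d, by omega⟩ (show N ≤ d by omega)) (hq ⟨d - 1, by omega⟩ (show N ≤ d - 1 by omega))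
    have := Fin.succAbove_left_injective (congrArg (fun f : Fin d ↪o Fin (d + 1) => ⇑f) hlast)
    simp only [Fin.mk.injEq] at this
    omega
  have hint := lintegral_indicator_feasible (P := P) hmeas e (φ := fun _ => 1) measurable_const
  have hz : ∫⁻ g, {g : Fin (d + 1) → G |
      Feasible (fun j => g (e (.inr j))) (A N fun i => g (e (.inl i)))}.indicator
        (fun _ => (1 : ENNReal)) g ∂sampleLaw P (d + 1) = 0 := by
    rw [lintegral_congr_ae (g := fun _ => 0), lintegral_zero]
    filter_upwards [hnot] with g hg
    exact Set.indicator_of_notMem hg _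
  have hr := measurable_risk (P := P) hmeas N
  rw [hz, eq_comm, lintegral_eq_zero_iff (by fun_prop)] at hint
  filter_upwards [hint] with g hg
  have h1 := (risk_mem_Icc (P := P) (A N g)).2
  simp only [one_mul, Pi.zero_apply, ENNReal.ofReal_eq_zero] at hg
  have h2 := pow_eq_zero_iff (M₀ := ℝ) (n := k + 2) (by omega) |>.1
    (le_antisymm hg (pow_nonneg (sub_nonneg.2 h1) _))
  linarith

end Law

/-! ### Exponential bounds for adaptively selected samples -/

section Selection

variable {Ω : Type*} {m : MeasurableSpace Ω} {μ : Measure Ω}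

/-- The product of nonnegative factors with mean at most one, selected by a predictable rule, is a
nonnegative supermartingale started at one. -/
theorem lintegral_prod_ite_le_one [IsProbabilityMeasure μ] {F H : ℕ → MeasurableSpace Ω}
    (hF : Monotone F)
    (hFm : ∀ t, F t ≤ m) (hHF : ∀ t, H t ≤ F (t + 1)) (hind : ∀ t, Indep (F t) (H t) μ)
    {n : ℕ → Ω → ℕ} (hn : ∀ t, Measurable[F t] (n t)) (N : ℕ) {Y : ℕ → Ω → ENNReal}
    (hY : ∀ t, Measurable[H t] (Y t)) (hY1 : ∀ t, ∫⁻ ω, Y t ω ∂μ ≤ 1) (t : ℕ) :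
    Measurable[F t] (fun ω => ∏ s ∈ Finset.range t, if n s ω = N then Y s ω else 1) ∧
      ∫⁻ ω, ∏ s ∈ Finset.range t, (if n s ω = N then Y s ω else 1) ∂μ ≤ 1 := by
  induction t with
  | zero => simp
  | succ t ih =>
    set W := fun ω => ∏ s ∈ Finset.range t, if n s ω = N then Y s ω else 1 with hW
    have hset : MeasurableSet[F t] {ω | n t ω = N} := hn t (measurableSet_singleton N)
    have hYm : Measurable[F (t + 1)] (Y t) := (hY t).mono (hHF t) le_rfl
    have hWt : Measurable[F (t + 1)] W := ih.1.mono (hF t.le_succ) le_rfl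
    simp_rw [Finset.prod_range_succ]
    constructor
    · refine Measurable.mul (m := F (t + 1)) hWt ?_
      exact Measurable.ite (m := F (t + 1)) (hF t.le_succ _ hset) hYm
        (@measurable_const _ _ _ (F (t + 1)) _)
    · set I := {ω | n t ω = N}.indicator W with hI
      set I' := {ω | n t ω = N}ᶜ.indicator W with hI'
      have hIm : Measurable[F t] I := Measurable.indicator (m := F t) ih.1 hset
      have hIm' : Measurable[F t] I' :=
        Measurable.indicator (m := F t) ih.1 (@MeasurableSet.compl _ _ (F t) hset)
      have e : ∀ ω, W ω * (if n t ω = N then Y t ω else 1) = I ω * Y t ω + I' ω := by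
        intro ω
        by_cases h : n t ω = N <;> simp [hI, hI', h]
      have e' : ∀ ω, I ω + I' ω = W ω := fun ω => Set.indicator_self_add_compl_apply _ _ _
      have hIm2 := hIm.mono (hFm t) le_rfl
      have hIm2' := hIm'.mono (hFm t) le_rfl
      calc ∫⁻ ω, W ω * (if n t ω = N then Y t ω else 1) ∂μ
          = ∫⁻ ω, I ω * Y t ω ∂μ + ∫⁻ ω, I' ω ∂μ := by
            rw [← lintegral_add_right _ hIm2']
            exact lintegral_congr e
        _ = (∫⁻ ω, I ω ∂μ) * ∫⁻ ω, Y t ω ∂μ + ∫⁻ ω, I' ω ∂μ := by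
            rw [lintegral_mul_eq_lintegral_mul_lintegral_of_independent_measurableSpace
              (hFm t) ((hHF t).trans (hFm _)) (hind t) hIm (hY t)]
        _ ≤ (∫⁻ ω, I ω ∂μ) * 1 + ∫⁻ ω, I' ω ∂μ := by gcongr; exact hY1 t
        _ = ∫⁻ ω, W ω ∂μ := by
            rw [mul_one, ← lintegral_add_right _ hIm2']
            exact lintegral_congr e'
        _ ≤ 1 := ih.2

/-- A sequence of nonnegative variables with bounded means grows subexponentially. -/
theorem ae_eventually_le_exp {W : ℕ → Ω → ENNReal} (hW : ∀ t, Measurable (W t))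
    (hW1 : ∀ t, ∫⁻ ω, W t ω ∂μ ≤ 1) :
    ∀ᵐ ω ∂μ, ∀ η : ℝ, 0 < η → ∀ᶠ t : ℕ in atTop, W t ω ≤ ENNReal.ofReal (Real.exp (η * t)) := by
  have key : ∀ k : ℕ, ∀ᵐ ω ∂μ, ∀ᶠ t : ℕ in atTop,
      W t ω ≤ ENNReal.ofReal (Real.exp (1 / ((k : ℝ) + 1) * t)) := by
    intro k
    set δ := 1 / ((k : ℝ) + 1) with hδ
    have hδ0 : 0 < δ := by positivity
    set q := ENNReal.ofReal (Real.exp (-δ)) with hq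
    have hq1 : q < 1 := by
      rw [hq, ← ENNReal.ofReal_one]
      exact (ENNReal.ofReal_lt_ofReal_iff one_pos).2 (Real.exp_lt_one_iff.2 (by linarith))
    have hqt : ∀ t : ℕ, q ^ t * ENNReal.ofReal (Real.exp (δ * t)) = 1 := by
      intro t
      rw [hq, ← ENNReal.ofReal_pow (Real.exp_pos _).le, ← ENNReal.ofReal_mul (by positivity),
        ← Real.exp_nat_mul, ← Real.exp_add]
      simp [mul_comm]
    have hfin : ∫⁻ ω, ∑' t, q ^ t * W t ω ∂μ ≠ ⊤ := by
      rw [lintegral_tsum fun t => ((hW t).const_mul _).aemeasurable]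
      refine ne_top_of_le_ne_top (b := ∑' t, q ^ t) ?_ (ENNReal.tsum_le_tsum fun t => ?_)
      · rw [ENNReal.tsum_geometric]
        exact ENNReal.inv_ne_top.2 (tsub_pos_of_lt hq1).ne'
      · rw [lintegral_const_mul _ (hW t)]
        exact mul_le_of_le_one_right' (hW1 t)
    filter_upwards [ae_lt_top (Measurable.tsum fun t => (hW t).const_mul _) hfin] with ω hω
    have ht := ENNReal.tendsto_atTop_zero_of_tsum_ne_top hω.ne
    filter_upwards [ht.eventually_le_const (show (0 : ENNReal) < 1 from one_pos)] with t ht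
    calc W t ω = q ^ t * W t ω * ENNReal.ofReal (Real.exp (δ * t)) := by
          rw [mul_right_comm, hqt, one_mul]
      _ ≤ 1 * ENNReal.ofReal (Real.exp (δ * t)) := by gcongr
      _ = _ := one_mul _
  filter_upwards [ae_all_iff.2 key] with ω hω η hη
  obtain ⟨k, hk⟩ := exists_nat_one_div_lt hη
  filter_upwards [hω k] with t ht
  refine ht.trans (ENNReal.ofReal_le_ofReal (Real.exp_le_exp.2 ?_))
  gcongr

/-- If `exp (ℓ / 2 + c)` has mean at most one, then the sum of `ℓ` over the steps selected by a
predictable rule is at most `-2 c` times their number, up to `o(t)`. -/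
theorem ae_eventually_sum_le [IsProbabilityMeasure μ] {F H : ℕ → MeasurableSpace Ω}
    (hF : Monotone F)
    (hFm : ∀ t, F t ≤ m) (hHF : ∀ t, H t ≤ F (t + 1)) (hind : ∀ t, Indep (F t) (H t) μ)
    {n : ℕ → Ω → ℕ} (hn : ∀ t, Measurable[F t] (n t)) (N : ℕ) {ℓ : ℕ → Ω → ℝ} (c : ℝ)
    (hℓ : ∀ t, Measurable[H t] (ℓ t))
    (hℓ1 : ∀ t, ∫⁻ ω, ENNReal.ofReal (Real.exp (ℓ t ω / 2 + c)) ∂μ ≤ 1) :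
    ∀ᵐ ω ∂μ, ∀ η : ℝ, 0 < η → ∀ᶠ t : ℕ in atTop,
      ∑ s ∈ Finset.range t with n s ω = N, (ℓ s ω + 2 * c) ≤ η * t := by
  have hY : ∀ t, Measurable[H t] fun ω => ENNReal.ofReal (Real.exp (ℓ t ω / 2 + c)) := fun t =>
    (show Measurable fun x : ℝ => ENNReal.ofReal (Real.exp (x / 2 + c)) by fun_prop).comp (hℓ t)
  have hW := lintegral_prod_ite_le_one hF hFm hHF hind hn N hY hℓ1
  filter_upwards [ae_eventually_le_exp (fun t => (hW t).1.mono (hFm t) le_rfl)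
    fun t => (hW t).2] with ω hω η hη
  filter_upwards [hω (η / 2) (by positivity)] with t ht
  rw [← Finset.prod_filter, ← ENNReal.ofReal_prod_of_nonneg (fun _ _ => (Real.exp_pos _).le),
    ENNReal.ofReal_le_ofReal_iff (Real.exp_pos _).le, ← Real.exp_sum, Real.exp_le_exp] at ht
  have : ∑ s ∈ Finset.range t with n s ω = N, (ℓ s ω + 2 * c) =
      2 * ∑ s ∈ Finset.range t with n s ω = N, (ℓ s ω / 2 + c) := by
    rw [Finset.mul_sum]
    exact Finset.sum_congr rfl fun s _ => by ring
  rw [this]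
  linarith

end Selection

/-! ### The data collected by the algorithm -/

section Data

theorem measurable_Gamma : Measurable Real.Gamma := by
  refine measurable_of_countable_not_continuousAt
    ((Set.countable_range fun k : ℕ => -(k : ℝ)).mono fun s hs => ?_)
  by_contra h
  exact hs (Real.differentiableAt_Gamma fun k hk => h ⟨k, hk.symm⟩).continuousAt

theorem measurable_modelConfidence (ε : ℝ) (N : ℕ) :
    Measurable fun θ => modelConfidence ε θ N := by
  have hG := measurable_Gamma
  have h : Measurable (Function.uncurry fun θ v : ℝ => betaLikelihood θ v N) := by
    unfold betaLikelihood beta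
    refine Measurable.ite ?_ measurable_const (Measurable.ite ?_ (by fun_prop) (by fun_prop))
    · exact (measurable_snd (measurableSet_singleton (0 : ℝ))).union (MeasurableSet.const _)
    · exact measurableSet_lt measurable_fst measurable_const
  simp only [modelConfidence, intervalIntegral]
  exact (h.stronglyMeasurable.integral_prod_right.sub
    h.stronglyMeasurable.integral_prod_right).measurable

theorem measurable_sizeEstimate (ε β : ℝ) : Measurable fun θ => sizeEstimate θ ε β := by
  have hm : ∀ N, MeasurableSet {θ | β ≤ modelConfidence ε θ N} := fun N =>
    measurableSet_le measurable_const (measurable_modelConfidence ε N)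
  refine measurable_of_Iio fun K => ?_
  cases K with
  | zero => simp
  | succ K =>
    -- Either some `N ≤ K` is admissible, or no `N` is and `sInf ∅ = 0`.
    have e : (fun θ => sizeEstimate θ ε β) ⁻¹' Set.Iio (K + 1) =
        (⋃ N ∈ Set.Iio (K + 1), {θ | β ≤ modelConfidence ε θ N}) ∪
          ⋂ N, {θ | β ≤ modelConfidence ε θ N}ᶜ := by
      ext θ
      simp only [Set.mem_preimage, Set.mem_Iio, Set.mem_union, Set.mem_iUnion, Set.mem_iInter,
        Set.mem_compl_iff, Set.mem_ofPred_eq, exists_prop]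
      constructor
      · intro h
        by_cases hne : ∃ N, β ≤ modelConfidence ε θ N
        · exact Or.inl ⟨_, h, Nat.sInf_mem (s := {N | β ≤ modelConfidence ε θ N}) hne⟩
        · exact Or.inr (not_exists.1 hne)
      · rintro (⟨N, hN, h⟩ | h)
        · exact (sizeEstimate_le h).trans_lt hN
        · have : {N | β ≤ modelConfidence ε θ N} = ∅ := Set.eq_empty_of_forall_notMem h
          have h0 : sizeEstimate θ ε β = sInf {N | β ≤ modelConfidence ε θ N} := rfl
          rw [h0, this, Nat.sInf_empty]
          omega
    rw [e]
    exact (MeasurableSet.biUnion (Set.to_countable _) fun N _ => hm N).union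
      (MeasurableSet.iInter fun N => (hm N).compl)

variable {X : Type*} {G : Set (X → ℝ)} [MeasurableSpace G] {P : Measure G}
  {A : (N : ℕ) → (Fin N → G) → X} {est : (M : ℕ) → (Fin M → ℝ × ℕ) → ℝ} {ε β : ℝ} {N₁ Nmax : ℕ}

theorem dataSet_apply (w : ℕ → ℕ → G) (t : ℕ) (j : Fin t) :
    dataSet P A est ε β N₁ Nmax w t j =
      (risk P (A (sampleSize P A est ε β N₁ Nmax w (j + 1)) fun i => w (j + 1) i),
        sampleSize P A est ε β N₁ Nmax w (j + 1)) := by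
  induction t with
  | zero => exact j.elim0
  | succ t ih =>
    refine Fin.lastCases ?_ (fun j => ?_) j
    · simp only [dataSet, Fin.snoc_last, Fin.val_last]
      rfl
    · simp only [dataSet, Fin.snoc_castSucc, Fin.val_castSucc]
      exact ih j

theorem sampleSize_add_two (w : ℕ → ℕ → G) (t : ℕ) :
    sampleSize P A est ε β N₁ Nmax w (t + 2) =
      min (sizeEstimate (estimate P A est ε β N₁ Nmax w (t + 1)) ε β) Nmax :=
  rfl

theorem measurable_nextSize (hest : ∀ M, Measurable (est M)) (t : ℕ) :
    Measurable (nextSize est ε β N₁ Nmax t) := by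
  cases t with
  | zero => exact measurable_const
  | succ t => exact ((measurable_sizeEstimate ε β).comp (hest (t + 1))).min measurable_const

/-- The sample size of step `t + 1` is a function of the constraints drawn up to step `t`. -/
theorem measurable_sampleSize [IsProbabilityMeasure P] (hmeas : MeasurableViolation A)
    (hest : ∀ M, Measurable (est M)) {Ω : Type*} [MeasurableSpace Ω] {g : ℕ → ℕ → Ω → G} (t : ℕ)
    (hg : ∀ s ≤ t, ∀ i, Measurable (g s i)) :
    Measurable fun ω => sampleSize P A est ε β N₁ Nmax (fun s i => g s i ω) (t + 1) := by
  induction t using Nat.strong_induction_on with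
  | _ t ih =>
    refine (measurable_nextSize hest t).comp (measurable_pi_lambda _ fun j => ?_)
    simp_rw [dataSet_apply]
    have hj := ih j j.2 fun s hs => hg s (hs.trans j.2.le)
    refine Measurable.prodMk ?_ hj
    have hpair : Measurable fun p : ℕ × Ω => risk P (A p.1 fun i => g (j + 1) i p.2) :=
      measurable_from_prod_countable_right fun N =>
        (measurable_risk hmeas N).comp (measurable_pi_lambda _ fun i => hg _ j.2 i)
    exact hpair.comp (hj.prodMk measurable_id)

variable {Ω : Type*} [MeasurableSpace Ω] {μ : Measure Ω}
  {g : ℕ → ℕ → Ω → G}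

theorem map_sample (hgm : ∀ t i, Measurable (g t i)) (hlaw : ∀ t i, μ.map (g t i) = P)
    (hindep : iIndepFun (fun p : ℕ × ℕ => g p.1 p.2) μ) (t N : ℕ) :
    μ.map (fun ω (i : Fin N) => g t i ω) = sampleLaw P N := by
  have h : iIndepFun (fun (i : Fin N) => g t i) μ :=
    hindep.precomp (g := fun i : Fin N => (t, (i : ℕ)))
      fun i j hij => Fin.ext (Prod.ext_iff.1 hij).2
  have h' := iIndepFun.map_fun_eq_pi_map (f := fun (i : Fin N) => g t i)
    (fun i => (hgm t i).aemeasurable) h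
  simp only [hlaw] at h'
  exact h'

/-- Almost surely the observed risks are one when fewer than `d` constraints are drawn, and lie
strictly between zero and one otherwise. -/
theorem ae_risk_mem [IsProbabilityMeasure P] {J : X → ℝ} {d : ℕ} (hA : IsScenarioSolution J P A)
    (hmeas : MeasurableViolation A) (hfix : HasFixedComplexity P A d) (hd : 0 < d)
    (hgm : ∀ t i, Measurable (g t i)) (hlaw : ∀ t i, μ.map (g t i) = P)
    (hindep : iIndepFun (fun p : ℕ × ℕ => g p.1 p.2) μ) :
    ∀ᵐ ω ∂μ, ∀ t N : ℕ, (N < d → risk P (A N fun i => g t i ω) = 1) ∧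
      (d ≤ N → risk P (A N fun i => g t i ω) ∈ Set.Ioo (0 : ℝ) 1) := by
  refine ae_all_iff.2 fun t => ae_all_iff.2 fun N => ?_
  have hm : Measurable fun ω (i : Fin N) => g t i ω := measurable_pi_lambda _ fun i => hgm t i
  have hr := measurable_risk (P := P) hmeas N
  have htr : ∀ p : (Fin N → G) → Prop, (∀ᵐ x ∂sampleLaw P N, p x) →
      ∀ᵐ ω ∂μ, p fun i => g t i ω := by
    intro p hp
    rw [← map_sample hgm hlaw hindep t N] at hp
    exact ae_of_ae_map hm.aemeasurable hp
  rcases lt_or_ge N d with h | h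
  · filter_upwards [htr _ (ae_risk_eq_one hA hmeas hfix h)] with ω hω
    exact ⟨fun _ => hω, fun h' => absurd h h'.not_gt⟩
  · have hB : ∀ᵐ v ∂betaMeasure d ((N : ℝ) - d + 1), v ∈ Set.Ioo (0 : ℝ) 1 :=
      betaMeasure_compl_Ioo _ _
    rw [← map_risk hA hmeas hfix hd h] at hB
    filter_upwards [htr _ (ae_of_ae_map hr.aemeasurable hB)] with ω hω
    exact ⟨fun h' => absurd h h'.not_ge, fun _ => hω⟩

/-- Over the steps with sample size `N ≥ d`, the log-likelihood ratio of a wrong complexity `θ'`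
against `d` decreases linearly in the number of steps, up to `o(t)`. -/
theorem ae_log_ratio_le [IsProbabilityMeasure μ] [IsProbabilityMeasure P] {J : X → ℝ} {d : ℕ}
    (hA : IsScenarioSolution J P A)
    (hmeas : MeasurableViolation A) (hfix : HasFixedComplexity P A d) (hd : 0 < d)
    (hest : ∀ M, Measurable (est M)) (hgm : ∀ t i, Measurable (g t i))
    (hlaw : ∀ t i, μ.map (g t i) = P) (hindep : iIndepFun (fun p : ℕ × ℕ => g p.1 p.2) μ)
    {N : ℕ} (hN : d ≤ N) {θ' : ℝ} (hθ' : θ' ∈ Set.Ioc 0 (N : ℝ)) (hne : θ' ≠ d) :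
    ∃ c : ℝ, 0 < c ∧ ∀ᵐ ω ∂μ, ∀ η : ℝ, 0 < η → ∀ᶠ t : ℕ in atTop,
      ∑ s ∈ Finset.range t with
          sampleSize P A est ε β N₁ Nmax (fun s i => g s i ω) (s + 1) = N,
        (Real.log (betaDensity N θ' (risk P (A N fun i => g (s + 1) i ω))) -
          Real.log (betaDensity N d (risk P (A N fun i => g (s + 1) i ω))) + c) ≤ η * t := by
  obtain ⟨c, hc, hc1⟩ := exists_lintegral_exp_log_ratio_le (θ₀ := d) (N := N)
    ⟨by exact_mod_cast hd, by exact_mod_cast hN⟩ hθ' hne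
  refine ⟨2 * c, by positivity, ?_⟩
  let ms : ℕ × ℕ → MeasurableSpace Ω := fun p => MeasurableSpace.comap (g p.1 p.2) inferInstance
  have hms : ∀ p, ms p ≤ ‹MeasurableSpace Ω› := fun p => (hgm p.1 p.2).comap_le
  let F : ℕ → MeasurableSpace Ω := fun t => ⨆ p ∈ {p : ℕ × ℕ | p.1 ≤ t}, ms p
  let H : ℕ → MeasurableSpace Ω := fun t => ⨆ p ∈ {p : ℕ × ℕ | p.1 = t + 1}, ms p
  have hF : Monotone F := fun s t hst => biSup_mono fun p (hp : p.1 ≤ s) => hp.trans hst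
  have hFm : ∀ t, F t ≤ ‹MeasurableSpace Ω› := fun t => iSup₂_le fun p _ => hms p
  have hHF : ∀ t, H t ≤ F (t + 1) := fun t => biSup_mono fun p (hp : p.1 = t + 1) => hp.le
  have hind : ∀ t, Indep (F t) (H t) μ := fun t =>
    indep_iSup_of_disjoint hms hindep.iIndep <| Set.disjoint_left.2
      fun p (hp : p.1 ≤ t) (hp' : p.1 = t + 1) => by omega
  have hn : ∀ t, Measurable[F t] fun ω =>
      sampleSize P A est ε β N₁ Nmax (fun s i => g s i ω) (t + 1) := fun t =>
    @measurable_sampleSize _ _ _ P A est ε β N₁ Nmax _ hmeas hest Ω (F t) g t fun s hs i =>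
      measurable_iff_comap_le.2
        (le_iSup₂_of_le (f := fun p (_ : p ∈ {p : ℕ × ℕ | p.1 ≤ t}) => ms p) (s, i) hs le_rfl)
  have hr := measurable_risk (P := P) hmeas N
  have hlog : Measurable fun v => Real.log (betaDensity N θ' v) - Real.log (betaDensity N d v) :=
    (measurable_betaDensity N θ').log.sub (measurable_betaDensity N d).log
  have hexp : Measurable fun v => ENNReal.ofReal (Real.exp
      ((Real.log (betaDensity N θ' v) - Real.log (betaDensity N d v)) / 2 + c)) :=
    (show Measurable fun x : ℝ => ENNReal.ofReal (Real.exp (x / 2 + c)) by fun_prop).comp hlog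
  have hexpr : Measurable fun x => ENNReal.ofReal (Real.exp ((Real.log (betaDensity N θ'
      (risk P (A N x))) - Real.log (betaDensity N d (risk P (A N x)))) / 2 + c)) := hexp.comp hr
  have hsamp : ∀ t, Measurable[H t] fun ω (i : Fin N) => g (t + 1) i ω := fun t =>
    @measurable_pi_lambda _ _ _ (H t) _ _ fun i => measurable_iff_comap_le.2
      (le_iSup₂_of_le (f := fun p (_ : p ∈ {p : ℕ × ℕ | p.1 = t + 1}) => ms p)
        (t + 1, (i : ℕ)) rfl le_rfl)
  refine ae_eventually_sum_le hF hFm hHF hind hn N c (fun t => hlog.comp (hr.comp (hsamp t)))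
    fun t => ?_
  have hm : Measurable fun ω (i : Fin N) => g (t + 1) i ω :=
    measurable_pi_lambda _ fun i => hgm _ i
  rw [← map_risk hA hmeas hfix hd hN, ← map_sample hgm hlaw hindep (t + 1) N,
    lintegral_map hexp hr, lintegral_map hexpr hm] at hc1
  exact hc1

end Data

/-! ### Consistency of the maximum likelihood estimates -/

theorem betaLikelihood_nonneg {θ v : ℝ} {N : ℕ} (hθ : 0 < θ) (hv : v ∈ Set.Icc (0 : ℝ) 1) :
    0 ≤ betaLikelihood θ v N := by
  have h1 : 0 ≤ 1 - v := by linarith [hv.2]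
  unfold betaLikelihood
  split_ifs with h h'
  · exact zero_le_one
  · exact div_nonneg (mul_nonneg (Real.rpow_nonneg hv.1 _) (Real.rpow_nonneg h1 _))
      (beta_pos hθ (by linarith)).le
  · exact mul_nonneg N.cast_nonneg (pow_nonneg hv.1 _)

theorem betaLikelihood_congr_of_le {θ θ' v : ℝ} {N : ℕ} (h : (N : ℝ) ≤ θ) (h' : (N : ℝ) ≤ θ') :
    betaLikelihood θ v N = betaLikelihood θ' v N := by
  simp [betaLikelihood, h.not_gt, h'.not_gt]

/-- A risk equal to one excludes all complexities below the sample size. -/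
theorem le_of_betaLikelihood_one_pos {θ : ℝ} {N : ℕ} (hθ : 0 < θ)
    (h : 0 < betaLikelihood θ 1 N) : (N : ℝ) ≤ θ := by
  by_contra! hlt
  have hN : N ≠ 0 := by
    rintro rfl
    exact absurd hlt (by simpa using hθ.le)
  rw [betaLikelihood, if_neg (by simp [hN]), if_pos hlt, sub_self,
    Real.zero_rpow (by linarith)] at h
  simp at h

theorem betaLikelihood_one_pos {θ : ℝ} {N : ℕ} (h : (N : ℝ) ≤ θ) : 0 < betaLikelihood θ 1 N := by
  unfold betaLikelihood
  split_ifs with h1 h2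
  · exact one_pos
  · exact absurd h2 h.not_gt
  · simp only [one_pow, mul_one]
    exact_mod_cast Nat.pos_of_ne_zero fun h => h1 (Or.inr h)

theorem sum_ennreal_log {M : ℕ} (f : Fin M → ENNReal) :
    ∑ j, ENNReal.log (f j) = ENNReal.log (∏ j, f j) := by
  induction M with
  | zero => simp
  | succ M ih => rw [Fin.sum_univ_succ, Fin.prod_univ_succ, ENNReal.log_mul_add, ih]

theorem prod_le_prod_of_logLikelihood_le {M : ℕ} (hM : 0 < M) {θ θ' : ℝ} {D : Fin M → ℝ × ℕ}
    (hθ : 0 < θ) (hθ' : 0 < θ') (hD : ∀ j, (D j).1 ∈ Set.Icc (0 : ℝ) 1)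
    (h : logLikelihood θ D ≤ logLikelihood θ' D) :
    ∏ j, betaLikelihood θ (D j).1 (D j).2 ≤ ∏ j, betaLikelihood θ' (D j).1 (D j).2 := by
  have hM' : (0 : EReal) < M := by exact_mod_cast hM
  rw [logLikelihood, logLikelihood, sum_ennreal_log, sum_ennreal_log,
    (EReal.strictMono_div_right_of_pos hM' (EReal.natCast_ne_top M)).le_iff_le,
    ENNReal.log_le_log_iff,
    ← ENNReal.ofReal_prod_of_nonneg fun j _ => betaLikelihood_nonneg hθ (hD j),
    ← ENNReal.ofReal_prod_of_nonneg fun j _ => betaLikelihood_nonneg hθ' (hD j),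
    ENNReal.ofReal_le_ofReal_iff
      (Finset.prod_nonneg fun j _ => betaLikelihood_nonneg hθ' (hD j))] at h
  exact h

/-- Sums with a linear negative drift in each class stay negative when the classes are reweighted
by bounded factors, uniformly in these factors. -/
theorem eventually_weighted_sum_neg {a b : ℕ} {n : ℕ → ℕ} {ℓ : ℕ → ℝ} (hb : ∀ s, n s ≤ b)
    (ha : ∀ᶠ s in atTop, a ≤ n s)
    (h : ∀ N ∈ Finset.Icc a b, ∃ c : ℝ, 0 < c ∧ ∀ η : ℝ, 0 < η → ∀ᶠ t : ℕ in atTop,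
      ∑ s ∈ Finset.range t with n s = N, (ℓ s + c) ≤ η * t) (Kmax : ℝ) :
    ∀ᶠ t in atTop, ∀ K : ℕ → ℝ, (∀ N ∈ Finset.Icc a b, 1 ≤ K N ∧ K N ≤ Kmax) →
      ∑ s ∈ Finset.range t with a ≤ n s, K (n s) * ℓ s < 0 := by
  choose! c hc hcη using h
  obtain ⟨c₀, hc₀, hc₀'⟩ : ∃ c₀ : ℝ, 0 < c₀ ∧ ∀ N ∈ Finset.Icc a b, c₀ ≤ c N := by
    have h1 : ∀ᶠ x : ℝ in 𝓝[>] 0, ∀ N ∈ Finset.Icc a b, x ≤ c N :=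
      (Finset.eventually_all _).2 fun N hN =>
        (eventually_le_nhds (hc N hN)).filter_mono nhdsWithin_le_nhds
    obtain ⟨x, hx, hx0⟩ := (h1.and self_mem_nhdsWithin).exists
    exact ⟨x, hx0, hx⟩
  obtain ⟨t₀, ht₀⟩ := eventually_atTop.1 ha
  set M := max Kmax 1 with hM
  have hM0 : 0 < M := lt_max_of_lt_right one_pos
  set η := c₀ / (2 * ((b : ℝ) + 1) * M) with hη
  have hη0 : 0 < η := by positivity
  filter_upwards [(Finset.eventually_all _).2 fun N hN => hcη N hN η hη0,
    eventually_gt_atTop (2 * t₀)] with t ht htt K hK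
  have hmaps : ∀ s ∈ {s ∈ Finset.range t | a ≤ n s}, n s ∈ Finset.Icc a b := fun s hs =>
    Finset.mem_Icc.2 ⟨(Finset.mem_filter.1 hs).2, hb s⟩
  have hsub : ∀ N ∈ Finset.Icc a b, {s ∈ {s ∈ Finset.range t | a ≤ n s} | n s = N} =
      {s ∈ Finset.range t | n s = N} := by
    intro N hN
    ext s
    simp only [Finset.mem_filter, Finset.mem_Icc] at hN ⊢
    exact ⟨fun h => ⟨h.1.1, h.2⟩, fun h => ⟨⟨h.1, h.2 ▸ hN.1⟩, h.2⟩⟩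
  have hclass : ∀ N ∈ Finset.Icc a b, ∑ s ∈ Finset.range t with n s = N, K (n s) * ℓ s ≤
      M * (η * t) - c₀ * ({s ∈ Finset.range t | n s = N}.card : ℝ) := by
    intro N hN
    have h1 : ∑ s ∈ Finset.range t with n s = N, K (n s) * ℓ s =
        K N * (∑ s ∈ Finset.range t with n s = N, (ℓ s + c N)) -
          K N * c N * ({s ∈ Finset.range t | n s = N}.card : ℝ) := by
      rw [Finset.sum_add_distrib, Finset.sum_const, nsmul_eq_mul, mul_add, Finset.mul_sum,
        Finset.sum_congr rfl fun s hs => by rw [(Finset.mem_filter.1 hs).2]]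
      ring
    have hK1 := (hK N hN).1
    have hKM : K N ≤ M := (hK N hN).2.trans (le_max_left _ _)
    have h2 : K N * (∑ s ∈ Finset.range t with n s = N, (ℓ s + c N)) ≤ M * (η * t) :=
      (mul_le_mul_of_nonneg_left (ht N hN) (by linarith)).trans
        (mul_le_mul_of_nonneg_right hKM (by positivity))
    have h3 : c₀ ≤ K N * c N := by nlinarith [hc₀' N hN]
    have h4 : c₀ * ({s ∈ Finset.range t | n s = N}.card : ℝ) ≤
        K N * c N * ({s ∈ Finset.range t | n s = N}.card : ℝ) := by gcongr
    linarith
  have hcard : (t : ℝ) - t₀ ≤ ({s ∈ Finset.range t | a ≤ n s}.card : ℝ) := by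
    have h1 : Finset.Ico t₀ t ⊆ {s ∈ Finset.range t | a ≤ n s} := fun s hs => by
      rw [Finset.mem_Ico] at hs
      exact Finset.mem_filter.2 ⟨Finset.mem_range.2 hs.2, ht₀ s hs.1⟩
    have h2 := Finset.card_le_card h1
    rw [Nat.card_Ico] at h2
    have h3 : t ≤ {s ∈ Finset.range t | a ≤ n s}.card + t₀ := by omega
    have h4 : (t : ℝ) ≤ ({s ∈ Finset.range t | a ≤ n s}.card : ℝ) + t₀ := by exact_mod_cast h3
    linarith
  have hIcc : ((Finset.Icc a b).card : ℝ) ≤ b + 1 := by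
    rw [Nat.card_Icc]
    exact_mod_cast Nat.sub_le (b + 1) a
  calc ∑ s ∈ Finset.range t with a ≤ n s, K (n s) * ℓ s
      = ∑ N ∈ Finset.Icc a b, ∑ s ∈ Finset.range t with n s = N, K (n s) * ℓ s := by
        rw [← Finset.sum_fiberwise_of_maps_to hmaps]
        exact Finset.sum_congr rfl fun N hN => by rw [hsub N hN]
    _ ≤ ∑ N ∈ Finset.Icc a b,
          (M * (η * t) - c₀ * ({s ∈ Finset.range t | n s = N}.card : ℝ)) :=
        Finset.sum_le_sum hclass
    _ = (Finset.Icc a b).card * (M * (η * t)) -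
          c₀ * ({s ∈ Finset.range t | a ≤ n s}.card : ℝ) := by
        rw [Finset.sum_sub_distrib, Finset.sum_const, nsmul_eq_mul, ← Finset.mul_sum,
          Finset.card_eq_sum_card_fiberwise (s := {s ∈ Finset.range t | a ≤ n s}) hmaps,
          Finset.sum_congr rfl fun N hN => by rw [← hsub N hN], Nat.cast_sum]
    _ ≤ (b + 1) * (M * (η * t)) - c₀ * ((t : ℝ) - t₀) := by gcongr
    _ = c₀ * (t₀ - t / 2) := by
        rw [hη]
        field_simp
        ring
    _ < 0 := by
        have : (2 : ℝ) * t₀ < t := by exact_mod_cast htt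
        exact mul_neg_of_pos_of_neg hc₀ (by linarith)

section Consistency

variable {d b : ℕ} {n : ℕ → ℕ} {v θ : ℕ → ℝ}

theorem betaLikelihood_complexity_pos (hd : 0 < d) {N : ℕ} {v : ℝ} (hlow : N < d → v = 1)
    (hhigh : d ≤ N → v ∈ Set.Ioo (0 : ℝ) 1) : 0 < betaLikelihood d v N := by
  rcases lt_or_ge N d with h | h
  · rw [hlow h]
    exact betaLikelihood_one_pos (by exact_mod_cast h.le)
  · have hv := hhigh h
    rw [betaLikelihood_eq_betaDensity (by omega) hv.1 hv.2]
    exact betaDensity_pos (lt_min (by exact_mod_cast hd) (by exact_mod_cast (by omega : 0 < N)))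
      (min_le_right _ _) hv.1 hv.2

/-- A set `U` of complexities is eventually avoided by the maximum likelihood estimates if, on
the steps with sample size at least `a`, the complexities in `U` lie beyond a point `θ'` as seen
from `d`, and the remaining steps do not separate `U` from `d`. By concavity of the log-likelihood
only the log-likelihood ratio of `θ'` against `d` matters. -/
theorem eventually_estimate_notMem (hd : 0 < d) (hlow : ∀ s, n s < d → v s = 1)
    (hhigh : ∀ s, d ≤ n s → v s ∈ Set.Ioo (0 : ℝ) 1) (hb : ∀ s, n s ≤ b)
    (hθ : ∀ t, 0 < t → 0 < θ t)
    (hmax : ∀ t, 0 < t → ∏ s ∈ Finset.range t, betaLikelihood d (v s) (n s) ≤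
      ∏ s ∈ Finset.range t, betaLikelihood (θ t) (v s) (n s))
    {a : ℕ} (hda : d ≤ a) (had : a ≤ d + 1) (ha : ∀ᶠ s in atTop, a ≤ n s) {θ' : ℝ}
    (hLR : ∀ N ∈ Finset.Icc a b, ∃ c : ℝ, 0 < c ∧ ∀ η : ℝ, 0 < η → ∀ᶠ t : ℕ in atTop,
      ∑ s ∈ Finset.range t with n s = N,
        (Real.log (betaDensity N θ' (v s)) - Real.log (betaDensity N d (v s)) + c) ≤ η * t)
    {U : Set ℝ} {K : ℝ → ℕ → ℝ} {Kmax : ℝ}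
    (hK : ∀ x ∈ U, 0 < x → ∀ N ∈ Finset.Icc a b, 1 ≤ K x N ∧ K x N ≤ Kmax ∧
      min x N - d = K x N * (θ' - d))
    (hU : ∀ x ∈ U, 0 < x → ∀ s, n s < a → 0 < betaLikelihood x (v s) (n s) → (n s : ℝ) ≤ x) :
    ∀ᶠ t in atTop, θ t ∉ U := by
  set ℓ : ℕ → ℝ := fun s =>
    Real.log (betaDensity (n s) θ' (v s)) - Real.log (betaDensity (n s) d (v s)) with hℓ
  have hneg := eventually_weighted_sum_neg (ℓ := ℓ) hb ha (fun N hN => by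
    obtain ⟨c, hc, h⟩ := hLR N hN
    refine ⟨c, hc, fun η hη => (h η hη).mono fun t ht => ?_⟩
    refine Eq.trans_le (Finset.sum_congr rfl fun s hs => ?_) ht
    rw [hℓ, ← (Finset.mem_filter.1 hs).2]) Kmax
  filter_upwards [hneg, eventually_gt_atTop 0] with t ht ht0 hmem
  have hpos := hθ t ht0
  have hfd : ∀ s, 0 < betaLikelihood d (v s) (n s) := fun s =>
    betaLikelihood_complexity_pos hd (hlow s) (hhigh s)
  have hfθ : ∀ s ∈ Finset.range t, 0 < betaLikelihood (θ t) (v s) (n s) := by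
    intro s hs
    refine lt_of_le_of_ne (betaLikelihood_nonneg hpos ?_) fun h0 => ?_
    · rcases lt_or_ge (n s) d with h | h
      · rw [hlow s h]
        exact ⟨zero_le_one, le_rfl⟩
      · exact Set.Ioo_subset_Icc_self (hhigh s h)
    · have := hmax t ht0
      rw [Finset.prod_eq_zero (f := fun s => betaLikelihood (θ t) (v s) (n s)) hs h0.symm] at this
      exact this.not_gt (Finset.prod_pos fun s _ => hfd s)
  have hsum : 0 ≤ ∑ s ∈ Finset.range t, (Real.log (betaLikelihood (θ t) (v s) (n s)) -
      Real.log (betaLikelihood d (v s) (n s))) := by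
    rw [Finset.sum_sub_distrib, ← Real.log_prod fun s hs => (hfθ s hs).ne',
      ← Real.log_prod fun s _ => (hfd s).ne', sub_nonneg]
    exact Real.log_le_log (Finset.prod_pos fun s _ => hfd s) (hmax t ht0)
  have hlt := ht (K (θ t)) fun N hN => ⟨(hK _ hmem hpos N hN).1, (hK _ hmem hpos N hN).2.1⟩
  refine (hsum.trans ?_).not_gt hlt
  rw [← Finset.sum_filter_add_sum_filter_not _ (fun s => a ≤ n s)]
  have hrest : ∑ s ∈ Finset.range t with ¬ a ≤ n s,
      (Real.log (betaLikelihood (θ t) (v s) (n s)) - Real.log (betaLikelihood d (v s) (n s))) = 0 :=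
    Finset.sum_eq_zero fun s hs => by
      obtain ⟨hs1, hs2⟩ := Finset.mem_filter.1 hs
      rw [betaLikelihood_congr_of_le (hU _ hmem hpos s (not_le.1 hs2) (hfθ s hs1))
        (show (n s : ℝ) ≤ d by exact_mod_cast (by omega : n s ≤ d)), sub_self]
  rw [hrest, add_zero]
  refine Finset.sum_le_sum fun s hs => ?_
  have has := (Finset.mem_filter.1 hs).2
  have hN : n s ∈ Finset.Icc a b := Finset.mem_Icc.2 ⟨has, hb s⟩
  have hv := hhigh s (hda.trans has)
  have hns : 0 < n s := by omega
  have hnd : (d : ℝ) ≤ n s := by exact_mod_cast hda.trans has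
  obtain ⟨h1, -, h3⟩ := hK _ hmem hpos _ hN
  rw [betaLikelihood_eq_betaDensity hns hv.1 hv.2, betaLikelihood_eq_betaDensity hns hv.1 hv.2,
    min_eq_left hnd]
  exact log_betaDensity_sub_le hv.1 hv.2
    ⟨lt_min hpos (by exact_mod_cast hns), min_le_right _ _⟩ ⟨by exact_mod_cast hd, hnd⟩ h1 h3

/-- Maximum likelihood estimates converge to `d` when the sample sizes follow the algorithm and
the log-likelihood ratios against `d` have negative drift. -/
theorem tendsto_estimate {ε β : ℝ} {Nmax : ℕ} (hε : 0 < ε) (hεβ : ε < β) (hβ : β < 1)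
    (hd : 0 < d) (hNmax : d < Nmax) (hlow : ∀ s, n s < d → v s = 1)
    (hhigh : ∀ s, d ≤ n s → v s ∈ Set.Ioo (0 : ℝ) 1) (hb : ∀ s, n s ≤ b)
    (hθ : ∀ t, 0 < t → 0 < θ t)
    (hmax : ∀ t, 0 < t → ∏ s ∈ Finset.range t, betaLikelihood d (v s) (n s) ≤
      ∏ s ∈ Finset.range t, betaLikelihood (θ t) (v s) (n s))
    (hn : ∀ t, 0 < t → n t = min (sizeEstimate (θ t) ε β) Nmax)
    (hLR : ∀ k : ℕ, ∀ θ' : ℝ, θ' = d - 1 / ((k : ℝ) + 2) ∨ θ' = d + 1 / ((k : ℝ) + 2) →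
      ∀ N : ℕ, d ≤ N → θ' ≤ N → ∃ c : ℝ, 0 < c ∧ ∀ η : ℝ, 0 < η → ∀ᶠ t : ℕ in atTop,
        ∑ s ∈ Finset.range t with n s = N,
          (Real.log (betaDensity N θ' (v s)) - Real.log (betaDensity N d (v s)) + c) ≤ η * t) :
    Tendsto θ atTop (𝓝 (d : ℝ)) := by
  have hdR : (1 : ℝ) ≤ d := by exact_mod_cast hd
  have hδ : ∀ k : ℕ, 0 < 1 / ((k : ℝ) + 2) ∧ 1 / ((k : ℝ) + 2) < 1 := fun k =>
    ⟨by positivity, by rw [div_lt_one (by positivity)]; linarith [k.cast_nonneg (α := ℝ)]⟩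
  -- A step with fewer than `d` constraints forces all later sample sizes to be larger.
  have hinc : ∀ s t, s < t → n s < d → n s < n t := by
    intro s t hst hs
    have ht0 : 0 < t := by omega
    have hle : (n s : ℝ) ≤ θ t := by
      refine le_of_betaLikelihood_one_pos (hθ t ht0) ?_
      rw [← hlow s hs]
      refine lt_of_le_of_ne (betaLikelihood_nonneg (hθ t ht0) ?_) fun h0 => ?_
      · rw [hlow s hs]
        exact ⟨zero_le_one, le_rfl⟩
      · have := hmax t ht0
        rw [Finset.prod_eq_zero (f := fun s => betaLikelihood (θ t) (v s) (n s))
          (Finset.mem_range.2 hst) h0.symm] at this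
        exact this.not_gt (Finset.prod_pos fun s _ =>
          betaLikelihood_complexity_pos hd (hlow s) (hhigh s))
    rw [hn t ht0]
    refine lt_min ?_ (hs.trans hNmax)
    exact_mod_cast hle.trans_lt (lt_sizeEstimate hε hεβ hβ (hθ t ht0))
  have hge : ∀ᶠ s in atTop, d ≤ n s := by
    have hfin : {s | n s < d}.Finite := by
      refine Set.Finite.of_finite_image ((Set.finite_Iio d).subset ?_) (f := n) ?_
      · rintro _ ⟨s, hs, rfl⟩
        exact hs
      · intro s hs t ht hst
        rcases lt_trichotomy s t with h | h | h
        · exact absurd hst (hinc s t h hs).ne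
        · exact h
        · exact absurd hst (hinc t s h ht).ne'
    have := hfin.compl_mem_cofinite
    rw [Nat.cofinite_eq_atTop] at this
    filter_upwards [this] with s hs
    exact not_lt.1 hs
  have hlower : ∀ k : ℕ, ∀ᶠ t in atTop, (d : ℝ) - 1 / ((k : ℝ) + 2) < θ t := by
    intro k
    obtain ⟨hδ0, hδ1⟩ := hδ k
    set δ := 1 / ((k : ℝ) + 2) with hδdef
    have := eventually_estimate_notMem (θ' := d - δ) (U := Set.Iic (d - δ))
      (K := fun x _ => (d - x) / δ) (Kmax := d / δ) hd hlow hhigh hb hθ hmax le_rfl d.le_succ hge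
      (fun N hN => hLR k _ (Or.inl rfl) N (Finset.mem_Icc.1 hN).1 (by
        have : (d : ℝ) ≤ N := by exact_mod_cast (Finset.mem_Icc.1 hN).1
        linarith))
      (fun x hx hx0 N hN => by
        have hxd : x ≤ d - δ := hx
        have : (d : ℝ) ≤ N := by exact_mod_cast (Finset.mem_Icc.1 hN).1
        refine ⟨by rw [le_div_iff₀ hδ0]; linarith, by gcongr; linarith, ?_⟩
        rw [min_eq_left (by linarith)]
        field_simp
        ring)
      (fun x hx hx0 s hs h => by
        rw [hlow s hs] at h
        exact le_of_betaLikelihood_one_pos hx0 h)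
    exact this.mono fun t ht => not_le.1 ht
  have hgt : ∀ᶠ s in atTop, d + 1 ≤ n s := by
    have hnear := eventually_le_sizeEstimate (M := d + 1) hε hεβ hβ hd fun N hN =>
      modelConfidence_lt_of_le hε hεβ hβ (Nat.lt_succ_iff.1 hN)
    obtain ⟨r, hr, hball⟩ := Metric.eventually_nhds_iff.1 hnear
    obtain ⟨k, hk⟩ := exists_nat_one_div_lt hr
    filter_upwards [hlower k, eventually_gt_atTop 0] with t ht ht0
    rw [hn t ht0]
    refine le_min ?_ hNmax
    rcases le_or_gt (d : ℝ) (θ t) with h | h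
    · exact_mod_cast h.trans_lt (lt_sizeEstimate hε hεβ hβ (hθ t ht0))
    · refine hball ?_
      have h2 : 1 / ((k : ℝ) + 2) ≤ 1 / ((k : ℝ) + 1) := by gcongr; norm_num
      rw [Real.dist_eq, abs_sub_lt_iff]
      constructor <;> linarith
  have hupper : ∀ k : ℕ, ∀ᶠ t in atTop, θ t < (d : ℝ) + 1 / ((k : ℝ) + 2) := by
    intro k
    obtain ⟨hδ0, hδ1⟩ := hδ k
    set δ := 1 / ((k : ℝ) + 2) with hδdef
    have hcast : ∀ N ∈ Finset.Icc (d + 1) b, (d : ℝ) + 1 ≤ N ∧ (N : ℝ) ≤ b := fun N hN =>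
      ⟨by exact_mod_cast (Finset.mem_Icc.1 hN).1, by exact_mod_cast (Finset.mem_Icc.1 hN).2⟩
    have := eventually_estimate_notMem (θ' := d + δ) (U := Set.Ici (d + δ))
      (K := fun x N => (min x N - d) / δ) (Kmax := b / δ) hd hlow hhigh hb hθ hmax d.le_succ
      le_rfl hgt
      (fun N hN => hLR k _ (Or.inr rfl) N (by have := Finset.mem_Icc.1 hN; omega) (by
        linarith [(hcast N hN).1]))
      (fun x hx hx0 N hN => by
        have hxd : d + δ ≤ x := hx
        have h1 := hcast N hN
        have h2 : min x (N : ℝ) ≤ N := min_le_right _ _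
        have h3 : d + δ ≤ min x (N : ℝ) := le_min hxd (by linarith)
        refine ⟨by rw [le_div_iff₀ hδ0]; linarith, by gcongr; linarith, ?_⟩
        rw [add_sub_cancel_left, div_mul_cancel₀ _ hδ0.ne'])
      (fun x hx hx0 s hs _ => by
        have hxd : d + δ ≤ x := hx
        have : (n s : ℝ) ≤ d := by exact_mod_cast Nat.lt_succ_iff.1 hs
        linarith)
    exact this.mono fun t ht => not_le.1 ht
  rw [Metric.tendsto_atTop']
  intro r hr
  obtain ⟨k, hk⟩ := exists_nat_one_div_lt hr
  have h2 : 1 / ((k : ℝ) + 2) ≤ 1 / ((k : ℝ) + 1) := by gcongr; norm_num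
  obtain ⟨T, hT⟩ := eventually_atTop.1 ((hlower k).and (hupper k))
  refine ⟨T, fun t ht => ?_⟩
  have := hT t ht.le
  rw [Real.dist_eq, abs_sub_lt_iff]
  constructor <;> linarith [this.1, this.2]

end Consistency

/-! ### Convergence of the algorithm -/

section Main

variable {X : Type*} {G : Set (X → ℝ)} [MeasurableSpace G] {J : X → ℝ} {P : Measure G}
  [IsProbabilityMeasure P] {A : (N : ℕ) → (Fin N → G) → X} {d : ℕ} {ε β : ℝ}

theorem confidence_eq_modelConfidence (hA : IsScenarioSolution J P A)
    (hmeas : MeasurableViolation A)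
    (hfix : HasFixedComplexity P A d) (hd : 0 < d) (h0 : 0 < ε) (h1 : ε < 1) {N : ℕ} (hN : d ≤ N) :
    confidence P A ε N = modelConfidence ε d N := by
  rw [← betaMeasure_real_Iic h0 h1 (by omega) (by exact_mod_cast hd) (by exact_mod_cast hN),
    ← map_risk hA hmeas hfix hd hN,
    map_measureReal_apply (measurable_risk hmeas N) measurableSet_Iic]
  rfl

theorem confidence_eq_zero (hA : IsScenarioSolution J P A) (hmeas : MeasurableViolation A)
    (hfix : HasFixedComplexity P A d) (h1 : ε < 1) {N : ℕ} (hN : N < d) :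
    confidence P A ε N = 0 := by
  rw [confidence, measureReal_eq_zero_iff, measure_eq_zero_iff_ae_notMem]
  filter_upwards [ae_risk_eq_one hA hmeas hfix hN] with g hg hle
  have : risk P (A N g) ≤ ε := hle
  linarith

theorem optimalSampleSize_spec (hA : IsScenarioSolution J P A) (hmeas : MeasurableViolation A)
    (hfix : HasFixedComplexity P A d) (hd : 0 < d) (hε : 0 < ε) (hεβ : ε < β) (hβ : β < 1) :
    d < optimalSampleSize P A ε β ∧ β ≤ modelConfidence ε d (optimalSampleSize P A ε β) ∧
      ∀ N < optimalSampleSize P A ε β, modelConfidence ε d N < β := by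
  have h1 := hεβ.trans hβ
  have hne : {N : ℕ | β ≤ confidence P A ε N}.Nonempty := by
    obtain ⟨N, hN, hle⟩ := exists_le_modelConfidence (θ := d) hε h1 hβ (by exact_mod_cast hd)
    exact ⟨N, hle.trans_eq
      (confidence_eq_modelConfidence hA hmeas hfix hd hε h1 (by exact_mod_cast hN.le)).symm⟩
  have hmem : β ≤ confidence P A ε (optimalSampleSize P A ε β) := Nat.sInf_mem hne
  have hdle : d ≤ optimalSampleSize P A ε β := by
    by_contra! h
    rw [confidence_eq_zero hA hmeas hfix h1 h] at hmem
    linarith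
  rw [confidence_eq_modelConfidence hA hmeas hfix hd hε h1 hdle] at hmem
  refine ⟨lt_of_le_of_ne hdle fun h => ?_, hmem, fun N hN => ?_⟩
  · exact hmem.not_gt (modelConfidence_lt_of_le hε hεβ hβ h.ge)
  · rcases le_or_gt N d with h | h
    · exact modelConfidence_lt_of_le hε hεβ hβ h
    · rw [← confidence_eq_modelConfidence hA hmeas hfix hd hε h1 h.le]
      exact not_le.1 (Nat.notMem_of_lt_sInf hN)

theorem ae_tendsto_estimate_of_measurable {N₁ Nmax : ℕ} (hA : IsScenarioSolution J P A)
    (hmeas : MeasurableViolation A) (hfix : HasFixedComplexity P A d) (hd : 0 < d) (hε : 0 < ε)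
    (hεβ : ε < β) (hβ : β < 1) (hNmax : d < Nmax) {est : (M : ℕ) → (Fin M → ℝ × ℕ) → ℝ}
    (hest : IsMLE est) {Ω : Type*} [MeasurableSpace Ω] {μ : Measure Ω} [IsProbabilityMeasure μ]
    {g : ℕ → ℕ → Ω → G} (hgm : ∀ t i, Measurable (g t i)) (hlaw : ∀ t i, μ.map (g t i) = P)
    (hindep : iIndepFun (fun p : ℕ × ℕ => g p.1 p.2) μ) :
    ∀ᵐ ω ∂μ, Tendsto (fun t => estimate P A est ε β N₁ Nmax (fun s i => g s i ω) t)
      atTop (𝓝 (d : ℝ)) := by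
  have hdR : (1 : ℝ) ≤ d := by exact_mod_cast hd
  have hratio : ∀ᵐ ω ∂μ, ∀ k : ℕ, ∀ σ ∈ ({-1, 1} : Set ℝ), ∀ N : ℕ, d ≤ N →
      d + σ * (1 / ((k : ℝ) + 2)) ≤ N → ∃ c : ℝ, 0 < c ∧ ∀ η : ℝ, 0 < η → ∀ᶠ t : ℕ in atTop,
        ∑ s ∈ Finset.range t with
            sampleSize P A est ε β N₁ Nmax (fun s i => g s i ω) (s + 1) = N,
          (Real.log (betaDensity N (d + σ * (1 / ((k : ℝ) + 2)))
              (risk P (A N fun i => g (s + 1) i ω))) -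
            Real.log (betaDensity N d (risk P (A N fun i => g (s + 1) i ω))) + c) ≤ η * t := by
    refine ae_all_iff.2 fun k => (ae_ball_iff (Set.to_countable _)).2 fun σ hσ =>
      ae_all_iff.2 fun N => ?_
    by_cases hN : d ≤ N
    · by_cases hN' : d + σ * (1 / ((k : ℝ) + 2)) ≤ N
      · have hδ0 : 0 < 1 / ((k : ℝ) + 2) := by positivity
        have hδ1 : 1 / ((k : ℝ) + 2) < 1 := by
          rw [div_lt_one (by positivity)]; linarith [k.cast_nonneg (α := ℝ)]
        obtain ⟨c, hc, h⟩ := ae_log_ratio_le (est := est) (ε := ε) (β := β) (N₁ := N₁)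
          (Nmax := Nmax) hA hmeas hfix hd hest.measurable hgm hlaw hindep hN
          (θ' := d + σ * (1 / ((k : ℝ) + 2)))
          ⟨by rcases hσ with rfl | rfl <;> linarith, hN'⟩
          (by rcases hσ with rfl | rfl <;> intro h <;> linarith)
        exact h.mono fun ω hω _ _ => ⟨c, hc, hω⟩
      · exact ae_of_all _ fun ω _ h => absurd h hN'
    · exact ae_of_all _ fun ω h => absurd h hN
  filter_upwards [hratio, ae_risk_mem hA hmeas hfix hd hgm hlaw hindep] with ω hω hrisk
  set w : ℕ → ℕ → G := fun s i => g s i ω with hw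
  have hprod : ∀ (t : ℕ) (x : ℝ), ∏ j : Fin t, betaLikelihood x
      (dataSet P A est ε β N₁ Nmax w t j).1 (dataSet P A est ε β N₁ Nmax w t j).2 =
      ∏ s ∈ Finset.range t, betaLikelihood x
        (risk P (A (sampleSize P A est ε β N₁ Nmax w (s + 1)) fun i => w (s + 1) i))
        (sampleSize P A est ε β N₁ Nmax w (s + 1)) := by
    intro t x
    simp_rw [dataSet_apply]
    exact Fin.prod_univ_eq_prod_range (fun s => betaLikelihood x
        (risk P (A (sampleSize P A est ε β N₁ Nmax w (s + 1)) fun i => w (s + 1) i))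
        (sampleSize P A est ε β N₁ Nmax w (s + 1))) t
  have hdata : ∀ t j, (dataSet P A est ε β N₁ Nmax w t j).1 ∈ Set.Icc (0 : ℝ) 1 := by
    intro t j
    rw [dataSet_apply]
    exact risk_mem_Icc _
  have hpos : ∀ t, 0 < t → 0 < estimate P A est ε β N₁ Nmax w t := fun t ht =>
    hest.pos t ht _ (hdata t)
  refine tendsto_estimate (b := max N₁ Nmax) (Nmax := Nmax)
    (n := fun s => sampleSize P A est ε β N₁ Nmax w (s + 1))
    (v := fun s => risk P (A (sampleSize P A est ε β N₁ Nmax w (s + 1)) fun i => w (s + 1) i))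
    hε hεβ hβ hd hNmax (fun s => (hrisk _ _).1) (fun s => (hrisk _ _).2) (fun s => ?_) hpos
    (fun t ht => ?_) (fun t ht => ?_) (fun k θ' hθ' N hN hN' => ?_)
  · cases s with
    | zero => exact le_max_left _ _
    | succ s => exact (min_le_right _ _).trans (le_max_right _ _)
  · have hdpos : (0 : ℝ) < d := by linarith
    have := prod_le_prod_of_logLikelihood_le ht hdpos (hpos t ht) (hdata t)
      (hest.isMax t ht _ (hdata t) d hdpos)
    rwa [hprod, hprod] at this
  · obtain ⟨s, rfl⟩ : ∃ s, t = s + 1 := ⟨t - 1, by omega⟩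
    exact sampleSize_add_two w s
  · obtain ⟨σ, hσ, rfl⟩ : ∃ σ ∈ ({-1, 1} : Set ℝ), θ' = d + σ * (1 / ((k : ℝ) + 2)) := by
      rcases hθ' with rfl | rfl
      · exact ⟨-1, by simp, by ring⟩
      · exact ⟨1, by simp, by ring⟩
    obtain ⟨c, hc, h⟩ := hω k σ hσ N hN hN'
    refine ⟨c, hc, fun η hη => (h η hη).mono fun t ht => ?_⟩
    refine Eq.trans_le (Finset.sum_congr rfl fun s hs => ?_) ht
    have hsN : sampleSize P A est ε β N₁ Nmax w (s + 1) = N := (Finset.mem_filter.1 hs).2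
    rw [hsN]

theorem eventually_sampleSize_mem {N₁ Nmax : ℕ} (hA : IsScenarioSolution J P A)
    (hmeas : MeasurableViolation A) (hfix : HasFixedComplexity P A d) (hd : 0 < d) (hε : 0 < ε)
    (hεβ : ε < β) (hβ : β < 1) (hNmax : optimalSampleSize P A ε β ≤ Nmax)
    {est : (M : ℕ) → (Fin M → ℝ × ℕ) → ℝ} {w : ℕ → ℕ → G}
    (h : Tendsto (fun t => estimate P A est ε β N₁ Nmax w t) atTop (𝓝 (d : ℝ))) :
    ∀ᶠ t in atTop, sampleSize P A est ε β N₁ Nmax w t ∈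
      Set.Icc (optimalSampleSize P A ε β) (optimalSampleSize P A ε β + 1) := by
  obtain ⟨h1, h2, h3⟩ := optimalSampleSize_spec hA hmeas hfix hd hε hεβ hβ
  have hev := h.eventually (eventually_sizeEstimate_mem hε hεβ hβ hd h1.le h3 h2)
  obtain ⟨T, hT⟩ := eventually_atTop.1 hev
  filter_upwards [eventually_ge_atTop (T + 2)] with t ht
  obtain ⟨s, rfl⟩ : ∃ s, t = s + 2 := ⟨t - 2, by omega⟩
  rw [sampleSize_add_two]
  have := hT (s + 1) (by omega)
  exact ⟨le_min this.1 hNmax, (min_le_left _ _).trans this.2⟩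

end Main

end Scenario
end

theorem theorem1 {X : Type*} {G : Set (X → ℝ)} [MeasurableSpace G]
    (J : X → ℝ) (P : Measure G) [IsProbabilityMeasure P]
    (A : (N : ℕ) → (Fin N → G) → X)
    (hA : Scenario.IsScenarioSolution J P A)
    (hmeas : Scenario.MeasurableViolation A)
    (d : ℕ) (hd : 0 < d) (hfix : Scenario.HasFixedComplexity P A d)
    (ε β : ℝ) (hε : 0 < ε) (hεβ : ε < β) (hβ : β < 1)
    (N₁ Nmax : ℕ) (hNmax : Scenario.optimalSampleSize P A ε β ≤ Nmax)
    (est : (M : ℕ) → (Fin M → ℝ × ℕ) → ℝ) (hest : Scenario.IsMLE est)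
    {Ω : Type*} [MeasurableSpace Ω] (μ : Measure Ω) [IsProbabilityMeasure μ]
    (g : ℕ → ℕ → Ω → G)
    (hlaw : ∀ t i, HasLaw (g t i) P μ)
    (hindep : iIndepFun (fun p : ℕ × ℕ => g p.1 p.2) μ) :
    ∀ᵐ ω ∂μ,
      Tendsto (fun t => Scenario.estimate P A est ε β N₁ Nmax (fun s i => g s i ω) t)
        atTop (𝓝 (d : ℝ)) ∧
      ∃ t₀ : ℕ, 0 < t₀ ∧ ∀ t, t₀ ≤ t →
        (Scenario.sampleSize P A est ε β N₁ Nmax (fun s i => g s i ω) t : ℤ) ∈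
          Set.Icc ((Scenario.optimalSampleSize P A ε β : ℤ) - 1)
            ((Scenario.optimalSampleSize P A ε β : ℤ) + 1) := by
  -- The constraints are only almost everywhere measurable: pass to measurable versions.
  choose g' hgm' hgg' using fun t i => (hlaw t i).aemeasurable
  have hlaw' : ∀ t i, μ.map (g' t i) = P := fun t i =>
    (Measure.map_congr (hgg' t i)).symm.trans (hlaw t i).map_eq
  have hindep' : iIndepFun (fun p : ℕ × ℕ => g' p.1 p.2) μ :=
    iIndepFun.congr (fun p : ℕ × ℕ => hgg' p.1 p.2) hindep
  have hdN := (Scenario.optimalSampleSize_spec hA hmeas hfix hd hε hεβ hβ).1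
  have hconv := Scenario.ae_tendsto_estimate_of_measurable (N₁ := N₁) hA hmeas hfix hd hε hεβ hβ
    (hdN.trans_le hNmax) hest hgm' hlaw' hindep'
  filter_upwards [hconv, ae_all_iff.2 fun t => ae_all_iff.2 fun i => hgg' t i] with ω hω heq
  have hw : (fun s i => g s i ω) = fun s i => g' s i ω := by
    funext s i
    exact heq s i
  rw [hw]
  refine ⟨hω, ?_⟩
  obtain ⟨T, hT⟩ := eventually_atTop.1
    (Scenario.eventually_sampleSize_mem hA hmeas hfix hd hε hεβ hβ hNmax hω)
  refine ⟨T + 1, T.succ_pos, fun t ht => ?_⟩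
  obtain ⟨h1, h2⟩ := hT t (by omega)
  constructor <;> omega
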